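/- Let $E$ be a countable set with a metric $d$, and let $(X_t)_{t\ge 0}$ be a regular, non-explosive continuous-time Markov chain on $E$, defined on a filtered measurable space, with jump rates $Q(x,y)\ge 0$ ($x\ne y$), $\sum_{y\neq x}Q(x,y)<\infty$ for every $x$; that is, its transition function $P_t(x,y)$ is the minimal non-negative solution of the backward equation of $Q$, and $\sum_y P_t(x,y)=1$. Write $\mathbb P_x,\mathbb E_x$ for probability and expectation given $X_0=x$, $P_tg(x)=\sum_y g(y)P_t(x,y)$, $\|g\|_\infty=\sup_x|g(x)|$, and $$\Gamma g(x)=\tfrac12\sum_{y\in E}(g(y)-g(x))^2Q(x,y)\in[0,\infty].$$ Let $\mathcal A$ be an algebra of real functions on $E$ that contains all bounded functions, and assume that the $\Gamma$-curvature is bounded below by $\rho\in\mathbb R$: for all $g\in\mathcal A$ and $t>0$ such that $P_tg$ is defined (the series converges absolutely at every point), and all $x\in E$, $$(\Gamma P_tg)^{1/2}(x)\le e^{-\rho t}\,P_t\big((\Gamma g)^{1/2}\big)(x).$$ Let $f\in\mathcal A$ be Lipschitz with $\|\Gamma f\|_\infty<\infty$ and Lipschitz seminorm $\|f\|_{\mathrm{Lip}}=\sup_{x\ne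 y}|f(x)-f(y)|/d(x,y)$. For $t>0$ let $L_{t,\rho}=(1-e^{-2\rho t})/(2\rho)$ if $\rho\ne0$, $L_{t,0}=t$, and for $\lambda\ge 0$ put $$\psi_{f,t}(\lambda)=\sqrt2\,L_{t,\rho}\,\|\Gamma f\|_\infty^{1/2}\,\Big\|\sum_{y\in E}(f(y)-f(\cdot))^2\Big(\frac{e^{\lambda\|f\|_{\mathrm{Lip}}d(\cdot,y)}-1}{\|f\|_{\mathrm{Lip}}d(\cdot,y)}\Big)^2Q(\cdot,y)\Big\|_\infty^{1/2}\in[0,\infty],$$ where terms with $f(y)=f(\cdot)$ are zero, and $M_{f,t}=\sup\{\lambda>0:\psi_{f,t}(\lambda)<\infty\}$ ($M_{f,t}=0$ if there is no such $\lambda$). Then for every $t>0$ and $x\in E$: 1. $f(X_t)$ is $\mathbb P_x$-integrable; 2. the Laplace transform $H(\lambda)=\mathbb E_x\big[\exp\{\lambda(f(X_t)-\mathbb E_x[f(X_t)])\}\big]$ is finite and differentiable on $(0,M_{f,t})$, and $H'(\lambda)\le\psi_{f,t}(\lambda)H(\lambda)$ there; 3. for every $y>0$, $$\mathbb P_x\big(f(X_t)-\mathbb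 E_x[f(X_t)]\ge y\big)\le\exp\Big(\inf_{\lambda\in(0,M_{f,t})}\int_0^\lambda(\psi_{f,t}(\tau)-y)\,d\tau\Big),$$ where the infimum is taken in $[-\infty,+\infty]$ (it is $+\infty$ if $M_{f,t}=0$) and $\exp(-\infty)=0$, $\exp(+\infty)=+\infty$. -/

import Mathlib

open MeasureTheory ProbabilityTheory
open scoped NNReal ENNReal

noncomputable section

namespace MarkovDeviation

variable {E : Type*}

/-- The total jump rate `q x = ∑_z Q(x, z)` out of `x` (for rates with `Q(x, x) = 0`). -/
def totalRate (Q : E → E → ℝ≥0) (x : E) : ℝ := ∑' z, (Q x z : ℝ)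

open Classical in
/-- `n`-th Picard iterate of the backward integral equation
`p_t(x, y) = 1_{x = y} e^{-q(x) t} + ∫_0^t e^{-q(x) s} ∑_z Q(x, z) p_{t - s}(z, y) ds`,
starting from `0`: the probability that the chain with jump rates `Q`, started at `x`, has made
at most `n - 1` jumps by time `t` and is then at `y`. -/
def transIter (Q : E → E → ℝ≥0) : ℕ → ℝ → E → E → ℝ≥0∞
  | 0, _, _, _ => 0
  | n + 1, t, x, y =>
      (if x = y then ENNReal.ofReal (Real.exp (-(totalRate Q x * t))) else 0) +
        ∫⁻ s in Set.Ioc 0 t, ENNReal.ofReal (Real.exp (-(totalRate Q x * s))) *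
          ∑' z, (Q x z : ℝ≥0∞) * transIter Q n (t - s) z y

/-- The transition function `P_t(x, y)` of the (minimal) continuous-time Markov chain with jump
rates `Q`, i.e. the smallest non-negative solution of the backward equation. -/
def transProb (Q : E → E → ℝ≥0) (t : ℝ) (x y : E) : ℝ≥0∞ := ⨆ n, transIter Q n t x y

/-- Regular, non-explosive jump rates: every state is stable (finite total jump rate; the rates are
conservative because the killing rate is zero), and the minimal chain does not explode, i.e. its
transition function has total mass one. Only the off-diagonal rates are data; the irrelevant
diagonal entries are normalised to `0`. -/
structure IsRegular (Q : E → E → ℝ≥0) : Prop where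
  diag : ∀ x, Q x x = 0
  stable : ∀ x, Summable (Q x)
  honest : ∀ t : ℝ, 0 ≤ t → ∀ x, ∑' y, transProb Q t x y = 1

/-- `X` is, on the filtered space `(Ω, ℱ)` and under the probability measures `Pr x` (the law given
`X_0 = x`), a Markov chain with the transition function of `Q`. The Markov property
`Pr x (X_{s+t} = y | ℱ_s) = P_t(X_s, y)` is written out on the events of `ℱ_s`, split according to
the value of `X_s`. -/
structure IsMarkovChain (Q : E → E → ℝ≥0) {Ω : Type*} {m : MeasurableSpace Ω}
    (ℱ : Filtration ℝ≥0 m) (Pr : E → Measure Ω) (X : ℝ≥0 → Ω → E) : Prop where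
  prob : ∀ x, IsProbabilityMeasure (Pr x)
  adapted : ∀ t y, MeasurableSet[ℱ t] (X t ⁻¹' {y})
  start : ∀ x, ∀ᵐ ω ∂(Pr x), X 0 ω = x
  markov : ∀ (x : E) (s t : ℝ≥0) (A : Set Ω), MeasurableSet[ℱ s] A → ∀ z y : E,
    Pr x (A ∩ X s ⁻¹' {z} ∩ X (s + t) ⁻¹' {y}) = Pr x (A ∩ X s ⁻¹' {z}) * transProb Q t z y

/-- The semigroup on real functions, `P_t f(x) = ∑_y f(y) P_t(x, y)`
(meaningful when the series converges absolutely). -/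
def semigroup (Q : E → E → ℝ≥0) (t : ℝ) (f : E → ℝ) (x : E) : ℝ :=
  ∑' y, f y * (transProb Q t x y).toReal

/-- The semigroup on `[0, ∞]`-valued functions. -/
def semigroupNonneg (Q : E → E → ℝ≥0) (t : ℝ) (F : E → ℝ≥0∞) (x : E) : ℝ≥0∞ :=
  ∑' y, F y * transProb Q t x y

/-- The carré du champ `Γ f(x) = ½ ∑_y (f(y) - f(x))² Q(x, y)`, in `[0, ∞]`. -/
def carre (Q : E → E → ℝ≥0) (f : E → ℝ) (x : E) : ℝ≥0∞ :=
  2⁻¹ * ∑' y, ENNReal.ofReal ((f y - f x) ^ 2) * (Q x y : ℝ≥0∞)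

/-- The supremum norm `‖Γ f‖_∞`, in `[0, ∞]`. -/
def carreSup (Q : E → E → ℝ≥0) (f : E → ℝ) : ℝ≥0∞ := ⨆ x, carre Q f x

/-- The `Γ`-curvature of the chain, relative to the class `𝒜`, is bounded below by `ρ`:
`(Γ P_t f)^{1/2}(x) ≤ e^{-ρ t} P_t (Γ f)^{1/2}(x)` for all `f ∈ 𝒜` (for which `P_t f` is defined),
all `x` and all `t > 0`. -/
def GammaCurvatureGE (Q : E → E → ℝ≥0) (𝒜 : Subalgebra ℝ (E → ℝ)) (ρ : ℝ) : Prop :=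
  ∀ f ∈ 𝒜, ∀ t : ℝ, 0 < t →
    (∀ x, Summable fun y => f y * (transProb Q t x y).toReal) →
    ∀ x, carre Q (semigroup Q t f) x ^ (1 / 2 : ℝ) ≤
      ENNReal.ofReal (Real.exp (-(ρ * t))) *
        semigroupNonneg Q t (fun z => carre Q f z ^ (1 / 2 : ℝ)) x

/-- The Lipschitz seminorm `sup_{x ≠ y} |f(x) - f(y)| / d(x, y)` of a Lipschitz function
(the pairs `x = y` contribute `0`). -/
def lipNorm [MetricSpace E] (f : E → ℝ) : ℝ :=
  ⨆ p : E × E, |f p.1 - f p.2| / dist p.1 p.2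

/-- `L_{t,ρ} = (1 - e^{-2ρt}) / (2ρ)` if `ρ ≠ 0`, and `t` otherwise. -/
def curvTime (t ρ : ℝ) : ℝ :=
  if ρ = 0 then t else (1 - Real.exp (-(2 * ρ * t))) / (2 * ρ)

/-- The function `ψ_{f,t}`, with values in `[0, ∞]`. Terms with `y = x`, and all terms if `f` is
constant, vanish because of the factor `(f(y) - f(x))²`. -/
def psi [MetricSpace E] (Q : E → E → ℝ≥0) (ρ : ℝ) (f : E → ℝ) (t l : ℝ) : ℝ≥0∞ :=
  ENNReal.ofReal (Real.sqrt 2 * curvTime t ρ) * carreSup Q f ^ (1 / 2 : ℝ) *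
    (⨆ x, ∑' y, ENNReal.ofReal ((f y - f x) ^ 2 *
      ((Real.exp (l * lipNorm f * dist x y) - 1) / (lipNorm f * dist x y)) ^ 2) *
        (Q x y : ℝ≥0∞)) ^ (1 / 2 : ℝ)

/-- `M_{f,t} = sup {l > 0 : ψ_{f,t}(l) < ∞}`, in `[0, ∞]` (`0` if there is no such `l`). -/
def psiRadius [MetricSpace E] (Q : E → E → ℝ≥0) (ρ : ℝ) (f : E → ℝ) (t : ℝ) : ℝ≥0∞ :=
  sSup (ENNReal.ofReal '' {l : ℝ | 0 < l ∧ psi Q ρ f t l < ⊤})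

/-- The open interval `(0, M_{f,t})`. -/
def psiInterval [MetricSpace E] (Q : E → E → ℝ≥0) (ρ : ℝ) (f : E → ℝ) (t : ℝ) : Set ℝ :=
  {l : ℝ | 0 < l ∧ ENNReal.ofReal l < psiRadius Q ρ f t}

end MarkovDeviation

end

/-!
The proof is Herbst's argument, run on truncations of `f` and started from a covariance inequality.

For bounded `u`, `v` the covariance `D_t = P_t(uv) - P_t u P_t v` solves
`∂_t D = L D + 2 Γ(P_t u, P_t v)` with `D_0 = 0`. If `Γ(u)^{1/2} ≤ A` and `Γ(v)^{1/2} ≤ κ w`, the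
Cauchy-Schwarz inequality and the curvature bound give
`2 Γ(P_t u, P_t v) ≤ 2 A κ e^{-2ρt} P_t w`, so `2 A κ L_{t,ρ} P_t w` is a supersolution of the same
equation, and `D_t ≤ 2 A κ L_{t,ρ} P_t w` (`IsRegular.covariance_le`). The comparison principle behind
this (`IsRegular.nonneg_of_supersolution`) needs only the backward equation for bounded functions and
non-explosion; the rates may be unbounded, and neither the forward equation nor stochastic calculus
enters.

Let `f_n` be the truncation of `f` to `[-n, n]`. It is bounded, hence in the class where the curvature
bound applies, and `Γ f_n ≤ Γ f`.

* With `u = v = f_n`, `w = 1`, the variances of `f_n(X_t)` are bounded uniformly in `n`, which makes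
  `f(X_t)` integrable (`integrable_of_variance_clamp_le`).
* With `u = f_n` and `v = w = e^{l f_n}`, convexity of `exp` and the Lipschitz bound give
  `Γ(v)^{1/2} ≤ κ v` with `2 A κ L_{t,ρ} = ψ(l)` (`carre_exp_le`, `psi_toReal`). The covariance
  inequality then says `(log E e^{l (f_n(X_t) - E f_n(X_t))})' ≤ ψ(l)`, hence
  `E e^{l (f_n(X_t) - E f_n(X_t))} ≤ exp (∫_0^l ψ)`.

Fatou's lemma removes the truncation from the exponential moments (`exp_moment_of_clamp`), dominated
convergence removes it from the differential inequality (`covariance_exp_le_of_clamp`), and Chernoff's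
bound gives the tail estimate.
-/

open MeasureTheory ProbabilityTheory
open scoped NNReal ENNReal

namespace MarkovDeviation

variable {E : Type*}

/-! ### The backward integral equation -/

/-- The expectation of `F(X_t)` on the event of at most `n - 1` jumps up to time `t`, namely
`∑_y F(y) p_n(t, x, y)` with the iterates `p_n = transIter Q n`. For `F = 1` this is the probability
of that event. -/
noncomputable def iterSemigroup (Q : E → E → ℝ≥0) (n : ℕ) (t : ℝ) (F : E → ℝ≥0∞) (x : E) : ℝ≥0∞ :=
  ∑' y, F y * transIter Q n t x y

theorem measurable_setLIntegral_Ioc {Φ : ℝ → ℝ → ℝ≥0∞} (hΦ : Measurable (Function.uncurry Φ)) :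
    Measurable fun t => ∫⁻ s in Set.Ioc 0 t, Φ t s := by
  have h : ∀ t, ∫⁻ s in Set.Ioc 0 t, Φ t s =
      ∫⁻ s, ({p : ℝ × ℝ | 0 < p.2 ∧ p.2 ≤ p.1}.indicator (Function.uncurry Φ)) (t, s) := by
    intro t
    rw [← lintegral_indicator measurableSet_Ioc]
    rfl
  simp_rw [h]
  apply Measurable.lintegral_prod_right'
  apply hΦ.indicator
  exact (measurableSet_lt measurable_const measurable_snd).inter
    (measurableSet_le measurable_snd measurable_fst)

theorem measurable_transIter [Countable E] (Q : E → E → ℝ≥0) (n : ℕ) (x y : E) :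
    Measurable fun t => transIter Q n t x y := by
  induction n generalizing x with
  | zero => exact measurable_const
  | succ n ih =>
    simp only [transIter]
    refine Measurable.add ?_ (measurable_setLIntegral_Ioc ?_)
    · split_ifs
      · fun_prop
      · exact measurable_const
    · refine Measurable.mul (by fun_prop) (Measurable.tsum fun z => ?_)
      exact ((ih z).comp (measurable_fst.sub measurable_snd)).const_mul _

theorem transIter_mono (Q : E → E → ℝ≥0) (t : ℝ) (x y : E) :
    Monotone fun n => transIter Q n t x y := by
  refine monotone_nat_of_le_succ fun n => ?_
  induction n generalizing t x with
  | zero => exact zero_le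
  | succ n ih =>
    rw [transIter, transIter]
    gcongr
    exact ih _ _

theorem tsum_iSup_of_monotone {ι : Type*} [Countable ι] {f : ℕ → ι → ℝ≥0∞} (hf : Monotone f) :
    ∑' i, ⨆ n, f n i = ⨆ n, ∑' i, f n i := by
  let _ : MeasurableSpace ι := ⊤
  simp_rw [← lintegral_count]
  exact lintegral_iSup (fun n => measurable_from_top) hf

theorem measurable_iterSemigroup [Countable E] (Q : E → E → ℝ≥0) (n : ℕ) (F : E → ℝ≥0∞) (x : E) :
    Measurable fun t => iterSemigroup Q n t F x :=
  Measurable.tsum fun y => (measurable_transIter Q n x y).const_mul _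

theorem iterSemigroup_mono (Q : E → E → ℝ≥0) (t : ℝ) (F : E → ℝ≥0∞) (x : E) :
    Monotone fun n => iterSemigroup Q n t F x := fun _ _ h =>
  ENNReal.tsum_le_tsum fun y => mul_le_mul_right (transIter_mono Q t x y h) _

theorem semigroupNonneg_eq_iSup [Countable E] (Q : E → E → ℝ≥0) (t : ℝ) (F : E → ℝ≥0∞) (x : E) :
    semigroupNonneg Q t F x = ⨆ n, iterSemigroup Q n t F x := by
  simp only [semigroupNonneg, transProb, iterSemigroup, ENNReal.mul_iSup]
  exact tsum_iSup_of_monotone fun n m h y => mul_le_mul_right (transIter_mono Q t x y h) _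

theorem measurable_semigroupNonneg [Countable E] (Q : E → E → ℝ≥0) (F : E → ℝ≥0∞) (x : E) :
    Measurable fun t => semigroupNonneg Q t F x := by
  simp_rw [semigroupNonneg_eq_iSup]
  exact Measurable.iSup fun n => measurable_iterSemigroup Q n F x

theorem iterSemigroup_succ [Countable E] (Q : E → E → ℝ≥0) (n : ℕ) (t : ℝ) (F : E → ℝ≥0∞) (x : E) :
    iterSemigroup Q (n + 1) t F x = F x * ENNReal.ofReal (Real.exp (-(totalRate Q x * t))) +
      ∫⁻ s in Set.Ioc 0 t, ENNReal.ofReal (Real.exp (-(totalRate Q x * s))) *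
          ∑' z, (Q x z : ℝ≥0∞) * iterSemigroup Q n (t - s) F z := by
  classical
  simp only [iterSemigroup, transIter, mul_add]
  rw [ENNReal.tsum_add]
  congr 1
  · rw [tsum_eq_single x]
    · simp
    · intro y hy
      simp [hy.symm]
  · have hm : ∀ y, Measurable fun s => ENNReal.ofReal (Real.exp (-(totalRate Q x * s))) *
        ∑' z, (Q x z : ℝ≥0∞) * transIter Q n (t - s) z y := fun y =>
      Measurable.mul (by fun_prop) (Measurable.tsum fun z =>
        ((measurable_transIter Q n z y).comp (measurable_const.sub measurable_id)).const_mul _)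
    simp_rw [← lintegral_const_mul _ (hm _)]
    rw [← lintegral_tsum fun y => ((hm y).const_mul _).aemeasurable]
    refine lintegral_congr fun s => ?_
    simp_rw [← ENNReal.tsum_mul_left]
    rw [ENNReal.tsum_comm]
    refine tsum_congr fun z => tsum_congr fun y => ?_
    ring

/-- The backward equation in integrated form, for `[0, ∞]`-valued initial data. -/
theorem semigroupNonneg_eq [Countable E] (Q : E → E → ℝ≥0) (t : ℝ) (F : E → ℝ≥0∞) (x : E) :
    semigroupNonneg Q t F x = F x * ENNReal.ofReal (Real.exp (-(totalRate Q x * t))) +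
      ∫⁻ s in Set.Ioc 0 t, ENNReal.ofReal (Real.exp (-(totalRate Q x * s))) *
          ∑' z, (Q x z : ℝ≥0∞) * semigroupNonneg Q (t - s) F z := by
  have h1 : ∀ s, ENNReal.ofReal (Real.exp (-(totalRate Q x * s))) *
      ∑' z, (Q x z : ℝ≥0∞) * semigroupNonneg Q (t - s) F z =
      ⨆ n, ENNReal.ofReal (Real.exp (-(totalRate Q x * s))) *
        ∑' z, (Q x z : ℝ≥0∞) * iterSemigroup Q n (t - s) F z := by
    intro s
    simp_rw [semigroupNonneg_eq_iSup, ENNReal.mul_iSup]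
    rw [tsum_iSup_of_monotone, ENNReal.mul_iSup]
    exact fun n m h z => mul_le_mul_right (iterSemigroup_mono Q _ F z h) _
  simp_rw [h1]
  rw [lintegral_iSup, ENNReal.add_iSup, semigroupNonneg_eq_iSup,
    ← (iterSemigroup_mono Q t F x).iSup_nat_add 1]
  · simp_rw [iterSemigroup_succ]
  · exact fun n => Measurable.mul (by fun_prop) (Measurable.tsum fun z =>
        ((measurable_iterSemigroup Q n F z).comp (measurable_const.sub measurable_id)).const_mul _)
  · intro n m h s
    exact mul_le_mul_right (ENNReal.tsum_le_tsum fun z =>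
      mul_le_mul_right (iterSemigroup_mono Q _ F z h) _) _

/-! ### The semigroup on bounded functions and the backward differential equation -/

/-- The generator `∑_z Q(x, z) (a(z) - a(x))`, used only on bounded functions `a`. -/
noncomputable def generator (Q : E → E → ℝ≥0) (a : E → ℝ) (x : E) : ℝ :=
  ∑' z, (Q x z : ℝ) * (a z - a x)

theorem IsRegular.summable_coe {Q : E → E → ℝ≥0} (hQ : IsRegular Q) (x : E) :
    Summable fun z => (Q x z : ℝ) := NNReal.summable_coe.2 (hQ.stable x)

theorem IsRegular.summable_mul {Q : E → E → ℝ≥0} (hQ : IsRegular Q) (x : E) {a : E → ℝ} {C : ℝ}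
    (ha : ∀ z, |a z| ≤ C) : Summable fun z => (Q x z : ℝ) * a z := by
  refine Summable.of_norm_bounded ((hQ.summable_coe x).mul_right C) fun z => ?_
  rw [norm_mul, Real.norm_eq_abs, Real.norm_eq_abs, NNReal.abs_eq]
  exact mul_le_mul_of_nonneg_left (ha z) (Q x z).2

theorem IsRegular.generator_eq {Q : E → E → ℝ≥0} (hQ : IsRegular Q) (x : E) {a : E → ℝ} {C : ℝ}
    (ha : ∀ z, |a z| ≤ C) :
    generator Q a x = (∑' z, (Q x z : ℝ) * a z) - totalRate Q x * a x := by
  simp only [generator, totalRate, mul_sub]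
  rw [(hQ.summable_mul x ha).tsum_sub ((hQ.summable_coe x).mul_right _), tsum_mul_right]

theorem totalRate_nonneg (Q : E → E → ℝ≥0) (x : E) : 0 ≤ totalRate Q x :=
  tsum_nonneg fun z => (Q x z).2

section Renewal

/- Here `A(t)` is given by a first-jump (renewal) equation whose right-hand side involves the family
`B(t, z)`. The case `A = B(·, x)` is the semigroup, and `A = p_{n+1}`, `B = p_n` are the iterates. -/
variable {Q : E → E → ℝ≥0} {x : E} {A : ℝ → ℝ≥0∞} {B : ℝ → E → ℝ≥0∞} {C u₀ : ℝ≥0}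

theorem renewal_integrableOn (hQ : IsRegular Q) [Countable E] (hBm : ∀ z, Measurable fun t => B t z)
    (hB : ∀ s, 0 ≤ s → ∀ z, B s z ≤ C) (t : ℝ) :
    IntegrableOn (fun r => Real.exp (totalRate Q x * r) *
      ∑' z, (Q x z : ℝ) * (B r z).toReal) (Set.Icc 0 t) := by
  refine Measure.integrableOn_of_bounded (M := Real.exp (totalRate Q x * t) *
    ∑' z, (Q x z : ℝ) * C) (by simp) ?_ ?_
  · refine (Measurable.mul (by fun_prop) (Measurable.tsum fun z => ?_)).aestronglyMeasurable
    exact (hBm z).ennreal_toReal.const_mul _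
  · refine (ae_restrict_iff' measurableSet_Icc).2 (Filter.Eventually.of_forall fun r hr => ?_)
    have hb : ∀ z, (B r z).toReal ≤ C := fun z =>
      ENNReal.toReal_le_of_le_ofReal C.2 (by simpa using hB r hr.1 z)
    rw [Real.norm_of_nonneg (by positivity)]
    gcongr
    · exact totalRate_nonneg Q x
    · exact hr.2
    · refine hQ.summable_mul x (C := C) fun z => ?_
      rw [abs_of_nonneg ENNReal.toReal_nonneg]
      exact hb z
    · exact (hQ.summable_coe x).mul_right _
    · exact hb _

/-- The renewal equation after the substitution `r = t - s`, which leaves `t` only in the upper limit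
and in the factor in front. -/
theorem renewal_toReal (hQ : IsRegular Q) [Countable E] (hBm : ∀ z, Measurable fun t => B t z)
    (hB : ∀ s, 0 ≤ s → ∀ z, B s z ≤ C)
    (hA : ∀ t, 0 ≤ t → A t = u₀ * ENNReal.ofReal (Real.exp (-(totalRate Q x * t))) +
      ∫⁻ s in Set.Ioc 0 t, ENNReal.ofReal (Real.exp (-(totalRate Q x * s))) *
          ∑' z, (Q x z : ℝ≥0∞) * B (t - s) z) {t : ℝ} (ht : 0 ≤ t) :
    (A t).toReal = Real.exp (-(totalRate Q x * t)) * (u₀ +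
      ∫ r in (0 : ℝ)..t, Real.exp (totalRate Q x * r) * ∑' z, (Q x z : ℝ) * (B r z).toReal) := by
  set q := totalRate Q x
  set R : ℝ → ℝ := fun r => ∑' z, (Q x z : ℝ) * (B r z).toReal with hR
  have hsum : ∀ r, 0 ≤ r → Summable fun z => (Q x z : ℝ) * (B r z).toReal := fun r hr =>
    hQ.summable_mul x (C := C) fun z => by
      rw [abs_of_nonneg ENNReal.toReal_nonneg]
      exact ENNReal.toReal_le_of_le_ofReal C.2 (by simpa using hB r hr z)
  have hR0 : ∀ r, 0 ≤ R r := fun r => tsum_nonneg fun z => by positivity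
  have h1 : ∫⁻ s in Set.Ioc 0 t, ENNReal.ofReal (Real.exp (-(q * s))) *
      ∑' z, (Q x z : ℝ≥0∞) * B (t - s) z =
      ∫⁻ s in Set.Ioc 0 t, ENNReal.ofReal (Real.exp (-(q * s)) * R (t - s)) := by
    refine setLIntegral_congr_fun measurableSet_Ioc fun s hs => ?_
    have hts : 0 ≤ t - s := by linarith [hs.2]
    rw [ENNReal.ofReal_mul (Real.exp_pos _).le, ENNReal.ofReal_tsum_of_nonneg
      (fun z => by positivity) (hsum _ hts)]
    congr 1
    refine tsum_congr fun z => ?_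
    rw [ENNReal.ofReal_mul (Q x z).coe_nonneg, ENNReal.ofReal_coe_nnreal, ENNReal.ofReal_toReal]
    exact ((hB _ hts z).trans_lt ENNReal.coe_lt_top).ne
  have hint := renewal_integrableOn (x := x) hQ hBm hB t
  have h3 : ∀ s, Real.exp (-(q * s)) * R (t - s) =
      (fun r => Real.exp (-(q * t)) * (Real.exp (q * r) * R r)) (t - s) := by
    intro s
    simp only
    rw [← mul_assoc, ← Real.exp_add]
    congr 2
    ring
  have hintv : IntervalIntegrable (fun r => Real.exp (-(q * t)) * (Real.exp (q * r) * R r))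
      volume 0 t := by
    refine IntervalIntegrable.const_mul ?_ _
    rw [intervalIntegrable_iff_integrableOn_Icc_of_le ht]
    exact hint
  have hint2 : IntegrableOn (fun s => Real.exp (-(q * s)) * R (t - s)) (Set.Ioc 0 t) := by
    rw [← intervalIntegrable_iff_integrableOn_Ioc_of_le ht]
    simp_rw [h3]
    simpa using (hintv.comp_sub_left t).symm
  rw [hA t ht, h1, ← ofReal_integral_eq_lintegral_ofReal hint2
    (Filter.Eventually.of_forall fun s => mul_nonneg (Real.exp_pos _).le (hR0 _)),
    ENNReal.toReal_add (by finiteness) (by finiteness), ENNReal.toReal_mul,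
    ENNReal.toReal_ofReal (Real.exp_pos _).le, ENNReal.toReal_ofReal
      (integral_nonneg fun s => mul_nonneg (Real.exp_pos _).le (hR0 _)),
    ← intervalIntegral.integral_of_le ht]
  simp_rw [h3]
  rw [intervalIntegral.integral_comp_sub_left
    (fun r => Real.exp (-(q * t)) * (Real.exp (q * r) * R r)), sub_self, sub_zero,
    intervalIntegral.integral_const_mul, mul_add, mul_comm]
  simp [hR]

theorem renewal_continuousOn (hQ : IsRegular Q) [Countable E] (hBm : ∀ z, Measurable fun t => B t z)
    (hB : ∀ s, 0 ≤ s → ∀ z, B s z ≤ C)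
    (hA : ∀ t, 0 ≤ t → A t = u₀ * ENNReal.ofReal (Real.exp (-(totalRate Q x * t))) +
      ∫⁻ s in Set.Ioc 0 t, ENNReal.ofReal (Real.exp (-(totalRate Q x * s))) *
          ∑' z, (Q x z : ℝ≥0∞) * B (t - s) z) (T : ℝ) :
    ContinuousOn (fun t => (A t).toReal) (Set.Icc 0 T) := by
  refine ContinuousOn.congr ?_ fun t ht => renewal_toReal hQ hBm hB hA ht.1
  refine ContinuousOn.mul (by fun_prop) (continuousOn_const.add ?_)
  have := intervalIntegral.continuousOn_primitive (renewal_integrableOn (x := x) hQ hBm hB T)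
  refine this.congr fun t ht => ?_
  rw [intervalIntegral.integral_of_le ht.1]

theorem renewal_hasDerivAt (hQ : IsRegular Q) [Countable E] (hBm : ∀ z, Measurable fun t => B t z)
    (hB : ∀ s, 0 ≤ s → ∀ z, B s z ≤ C)
    (hA : ∀ t, 0 ≤ t → A t = u₀ * ENNReal.ofReal (Real.exp (-(totalRate Q x * t))) +
      ∫⁻ s in Set.Ioc 0 t, ENNReal.ofReal (Real.exp (-(totalRate Q x * s))) *
          ∑' z, (Q x z : ℝ≥0∞) * B (t - s) z)
    (hBc : ∀ z T, ContinuousOn (fun t => (B t z).toReal) (Set.Icc 0 T)) {t : ℝ} (ht : 0 < t) :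
    HasDerivAt (fun t => (A t).toReal)
      ((∑' z, (Q x z : ℝ) * (B t z).toReal) - totalRate Q x * (A t).toReal) t := by
  have hnear : Set.Icc 0 (t + 1) ∈ nhds t := Icc_mem_nhds ht (by linarith)
  have hRc : ContinuousOn (fun r => ∑' z, (Q x z : ℝ) * (B r z).toReal) (Set.Icc 0 (t + 1)) := by
    refine continuousOn_tsum (u := fun z => (Q x z : ℝ) * C)
      (fun z => continuousOn_const.mul (hBc z _)) ((hQ.summable_coe x).mul_right _) ?_
    intro z r hr
    rw [Real.norm_of_nonneg (by positivity)]
    gcongr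
    exact ENNReal.toReal_le_of_le_ofReal C.2 (by simpa using hB r hr.1 z)
  have hprim : HasDerivAt (fun t => ∫ r in (0 : ℝ)..t, Real.exp (totalRate Q x * r) *
      ∑' z, (Q x z : ℝ) * (B r z).toReal)
      (Real.exp (totalRate Q x * t) * ∑' z, (Q x z : ℝ) * (B t z).toReal) t := by
    refine intervalIntegral.integral_hasDerivAt_right ?_ ?_ ?_
    · rw [intervalIntegrable_iff_integrableOn_Icc_of_le ht.le]
      exact renewal_integrableOn hQ hBm hB t
    · refine Measurable.stronglyMeasurable ?_ |>.stronglyMeasurableAtFilter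
      exact Measurable.mul (by fun_prop)
        (Measurable.tsum fun z => (hBm z).ennreal_toReal.const_mul _)
    · exact ContinuousAt.mul (by fun_prop) (hRc.continuousAt hnear)
  have hexp : HasDerivAt (fun t => Real.exp (-(totalRate Q x * t)))
      (Real.exp (-(totalRate Q x * t)) * (-(totalRate Q x * 1))) t :=
    (((hasDerivAt_id t).const_mul _).neg).exp
  have := hexp.mul (hprim.const_add (u₀ : ℝ))
  refine (this.congr_of_eventuallyEq ?_).congr_deriv ?_
  · filter_upwards [hnear] with r hr using renewal_toReal hQ hBm hB hA hr.1
  · rw [renewal_toReal hQ hBm hB hA ht.le, ← mul_assoc, ← Real.exp_add]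
    simp
    ring

end Renewal

section Semigroup

variable {Q : E → E → ℝ≥0}

theorem IsRegular.summable_transProb (hQ : IsRegular Q) {t : ℝ} (ht : 0 ≤ t) (x : E) :
    Summable fun y => (transProb Q t x y).toReal :=
  ENNReal.summable_toReal (by rw [hQ.honest t ht x]; simp)

theorem IsRegular.transProb_ne_top (hQ : IsRegular Q) {t : ℝ} (ht : 0 ≤ t) (x y : E) :
    transProb Q t x y ≠ ⊤ :=
  ENNReal.ne_top_of_tsum_ne_top (by rw [hQ.honest t ht x]; simp) y

theorem IsRegular.tsum_transProb_toReal (hQ : IsRegular Q) {t : ℝ} (ht : 0 ≤ t) (x : E) :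
    ∑' y, (transProb Q t x y).toReal = 1 := by
  rw [← ENNReal.tsum_toReal_eq fun y => hQ.transProb_ne_top ht x y, hQ.honest t ht x]
  rfl

theorem IsRegular.summable_semigroup (hQ : IsRegular Q) {t : ℝ} (ht : 0 ≤ t) (x : E)
    {u : E → ℝ} {C : ℝ} (hu : ∀ y, |u y| ≤ C) :
    Summable fun y => u y * (transProb Q t x y).toReal := by
  refine Summable.of_norm_bounded ((hQ.summable_transProb ht x).mul_left C) fun y => ?_
  rw [norm_mul, Real.norm_eq_abs, Real.norm_of_nonneg ENNReal.toReal_nonneg]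
  exact mul_le_mul_of_nonneg_right (hu y) ENNReal.toReal_nonneg

theorem IsRegular.semigroup_const (hQ : IsRegular Q) {t : ℝ} (ht : 0 ≤ t) (x : E) (c : ℝ) :
    semigroup Q t (fun _ => c) x = c := by
  rw [semigroup, tsum_mul_left, hQ.tsum_transProb_toReal ht, mul_one]

theorem IsRegular.semigroup_mono (hQ : IsRegular Q) {t : ℝ} (ht : 0 ≤ t) (x : E)
    {u v : E → ℝ} {C D : ℝ} (hu : ∀ y, |u y| ≤ C) (hv : ∀ y, |v y| ≤ D) (h : ∀ y, u y ≤ v y) :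
    semigroup Q t u x ≤ semigroup Q t v x :=
  (hQ.summable_semigroup ht x hu).tsum_le_tsum
    (fun y => mul_le_mul_of_nonneg_right (h y) ENNReal.toReal_nonneg)
    (hQ.summable_semigroup ht x hv)

theorem IsRegular.abs_semigroup_le (hQ : IsRegular Q) {t : ℝ} (ht : 0 ≤ t) (x : E)
    {u : E → ℝ} {C : ℝ} (hu : ∀ y, |u y| ≤ C) : |semigroup Q t u x| ≤ C := by
  rw [abs_le]
  constructor
  · rw [← hQ.semigroup_const ht x (-C)]
    exact hQ.semigroup_mono ht x (fun _ => le_rfl) hu fun y => (abs_le.1 (hu y)).1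
  · rw [← hQ.semigroup_const ht x C]
    exact hQ.semigroup_mono ht x hu (fun _ => le_rfl) fun y => (abs_le.1 (hu y)).2

theorem IsRegular.semigroupNonneg_ofReal (hQ : IsRegular Q) {t : ℝ} (ht : 0 ≤ t) (x : E)
    {u : E → ℝ} {C : ℝ} (hu : ∀ y, |u y| ≤ C) (h0 : ∀ y, 0 ≤ u y) :
    semigroupNonneg Q t (fun y => ENNReal.ofReal (u y)) x = ENNReal.ofReal (semigroup Q t u x) := by
  rw [semigroup, ENNReal.ofReal_tsum_of_nonneg
    (fun y => mul_nonneg (h0 y) ENNReal.toReal_nonneg) (hQ.summable_semigroup ht x hu)]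
  refine tsum_congr fun y => ?_
  rw [ENNReal.ofReal_mul (h0 y), ENNReal.ofReal_toReal (hQ.transProb_ne_top ht x y)]

theorem IsRegular.semigroup_add_const (hQ : IsRegular Q) {t : ℝ} (ht : 0 ≤ t) (x : E)
    {u : E → ℝ} {C : ℝ} (hu : ∀ y, |u y| ≤ C) (c : ℝ) :
    semigroup Q t (fun y => u y + c) x = semigroup Q t u x + c := by
  simp only [semigroup, add_mul]
  rw [(hQ.summable_semigroup ht x hu).tsum_add ((hQ.summable_transProb ht x).mul_left c),
    tsum_mul_left, hQ.tsum_transProb_toReal ht, mul_one]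

theorem IsRegular.semigroupNonneg_le [Countable E] (hQ : IsRegular Q) {t : ℝ} (ht : 0 ≤ t) (x : E)
    {F : E → ℝ≥0∞} {C : ℝ≥0∞} (hF : ∀ y, F y ≤ C) : semigroupNonneg Q t F x ≤ C := by
  calc semigroupNonneg Q t F x ≤ ∑' y, C * transProb Q t x y :=
        ENNReal.tsum_le_tsum fun y => mul_le_mul_left (hF y) _
    _ = C := by rw [ENNReal.tsum_mul_left, hQ.honest t ht x, mul_one]

theorem semigroup_zero [Countable E] (hQ : IsRegular Q) {u : E → ℝ} {C : ℝ} (hu : ∀ y, |u y| ≤ C)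
    (x : E) : semigroup Q 0 u x = u x := by
  have hu' : ∀ y, 0 ≤ u y + C := fun y => by linarith [(abs_le.1 (hu y)).1]
  have hu2 : ∀ y, |u y + C| ≤ C + C := fun y => by
    rw [abs_of_nonneg (hu' y)]; linarith [(abs_le.1 (hu y)).2]
  have h := hQ.semigroupNonneg_ofReal le_rfl x hu2 hu'
  rw [semigroupNonneg_eq, hQ.semigroup_add_const le_rfl x hu] at h
  simp only [mul_zero, neg_zero, Real.exp_zero, ENNReal.ofReal_one, mul_one, Set.Ioc_self,
    Measure.restrict_empty, lintegral_zero_measure, add_zero] at h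
  have h2 : 0 ≤ semigroup Q 0 u x + C := by
    linarith [(abs_le.1 (hQ.abs_semigroup_le le_rfl x hu)).1]
  linarith [(ENNReal.ofReal_eq_ofReal_iff (hu' x) h2).1 h]

/-- Continuity in time and the backward equation for non-negative bounded `u`. Honesty extends them to
signed `u` by adding a constant. -/
theorem IsRegular.backward_of_nonneg [Countable E] (hQ : IsRegular Q) {u : E → ℝ} {C : ℝ}
    (hu : ∀ y, |u y| ≤ C) (h0 : ∀ y, 0 ≤ u y) (x : E) :
    (∀ T, ContinuousOn (fun t => semigroup Q t u x) (Set.Icc 0 T)) ∧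
    ∀ t, 0 < t → HasDerivAt (fun t => semigroup Q t u x) (generator Q (semigroup Q t u) x) t := by
  have hC : 0 ≤ C := (abs_nonneg _).trans (hu x)
  have hm := measurable_semigroupNonneg Q fun y => ENNReal.ofReal (u y)
  have hB : ∀ s, 0 ≤ s → ∀ z, semigroupNonneg Q s (fun y => ENNReal.ofReal (u y)) z ≤ C.toNNReal :=
    fun s hs z => hQ.semigroupNonneg_le hs z fun y =>
      ENNReal.ofReal_le_ofReal ((le_abs_self _).trans (hu y))
  have hren := fun (z : E) (t : ℝ) (_ : 0 ≤ t) =>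
    semigroupNonneg_eq Q t (fun y => ENNReal.ofReal (u y)) z
  have heq : ∀ z t, 0 ≤ t → semigroup Q t u z =
      (semigroupNonneg Q t (fun y => ENNReal.ofReal (u y)) z).toReal := fun z t ht => by
    rw [hQ.semigroupNonneg_ofReal ht z hu h0, ENNReal.toReal_ofReal]
    exact tsum_nonneg fun y => mul_nonneg (h0 y) ENNReal.toReal_nonneg
  have hcont := fun z => renewal_continuousOn (x := z) (u₀ := (u z).toNNReal) hQ hm hB (hren z)
  refine ⟨fun T => (hcont x T).congr fun t ht => heq x t ht.1, fun t ht => ?_⟩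
  have hd := renewal_hasDerivAt (x := x) (u₀ := (u x).toNNReal) hQ hm hB (hren x) hcont ht
  refine (hd.congr_of_eventuallyEq ?_).congr_deriv ?_
  · filter_upwards [lt_mem_nhds ht] with s hs using heq x s hs.le
  · rw [hQ.generator_eq x fun z => hQ.abs_semigroup_le ht.le z hu]
    simp_rw [heq _ t ht.le]

theorem IsRegular.semigroup_continuousOn [Countable E] (hQ : IsRegular Q) {u : E → ℝ} {C : ℝ}
    (hu : ∀ y, |u y| ≤ C) (x : E) (T : ℝ) :
    ContinuousOn (fun t => semigroup Q t u x) (Set.Icc 0 T) := by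
  have hu' : ∀ y, 0 ≤ u y + C := fun y => by linarith [(abs_le.1 (hu y)).1]
  have hu2 : ∀ y, |u y + C| ≤ C + C := fun y => by
    rw [abs_of_nonneg (hu' y)]; linarith [(abs_le.1 (hu y)).2]
  refine (((hQ.backward_of_nonneg hu2 hu' x).1 T).sub (continuousOn_const (c := C))).congr fun t ht => ?_
  simp only [Pi.sub_apply]
  rw [hQ.semigroup_add_const ht.1 x hu]
  ring

/-- The backward equation `∂_t P_t u = L P_t u` for bounded `u`; no forward equation is needed
below. -/
theorem IsRegular.semigroup_hasDerivAt [Countable E] (hQ : IsRegular Q) {u : E → ℝ} {C : ℝ}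
    (hu : ∀ y, |u y| ≤ C) (x : E) {t : ℝ} (ht : 0 < t) :
    HasDerivAt (fun t => semigroup Q t u x) (generator Q (semigroup Q t u) x) t := by
  have hu' : ∀ y, 0 ≤ u y + C := fun y => by linarith [(abs_le.1 (hu y)).1]
  have hu2 : ∀ y, |u y + C| ≤ C + C := fun y => by
    rw [abs_of_nonneg (hu' y)]; linarith [(abs_le.1 (hu y)).2]
  refine ((((hQ.backward_of_nonneg hu2 hu' x).2 t ht).sub_const C).congr_of_eventuallyEq ?_).congr_deriv
    ?_
  · filter_upwards [lt_mem_nhds ht] with s hs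
    rw [hQ.semigroup_add_const hs.le x hu]
    ring
  · simp only [generator, hQ.semigroup_add_const ht.le _ hu, add_sub_add_right_eq_sub]

end Semigroup

variable {Q : E → E → ℝ≥0}

/-! ### Comparison principle -/

section Comparison

theorem IsRegular.iterSemigroup_one_le [Countable E] (hQ : IsRegular Q) (n : ℕ) {t : ℝ}
    (ht : 0 ≤ t) (x : E) : iterSemigroup Q n t 1 x ≤ 1 := by
  calc iterSemigroup Q n t 1 x ≤ semigroupNonneg Q t 1 x := by
        rw [semigroupNonneg_eq_iSup]
        exact le_iSup (fun n => iterSemigroup Q n t 1 x) n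
    _ ≤ 1 := hQ.semigroupNonneg_le ht x fun _ => le_rfl

theorem iterSemigroup_one_at_zero [Countable E] (Q : E → E → ℝ≥0) (n : ℕ) (x : E) :
    iterSemigroup Q (n + 1) 0 1 x = 1 := by
  rw [iterSemigroup_succ]
  simp

theorem IsRegular.iterSemigroup_one_continuousOn [Countable E] (hQ : IsRegular Q) (n : ℕ) (x : E)
    (T : ℝ) : ContinuousOn (fun t => (iterSemigroup Q n t 1 x).toReal) (Set.Icc 0 T) := by
  cases n with
  | zero =>
    simp only [iterSemigroup, transIter, mul_zero, tsum_zero]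
    exact continuousOn_const
  | succ n =>
    exact renewal_continuousOn (x := x) (u₀ := 1) (C := 1) hQ (measurable_iterSemigroup Q n 1)
      (fun s hs z => by simpa using hQ.iterSemigroup_one_le n hs z)
      (fun t _ => by rw [iterSemigroup_succ]; simp) T

theorem IsRegular.iterSemigroup_one_hasDerivAt [Countable E] (hQ : IsRegular Q) (n : ℕ) (x : E)
    {t : ℝ} (ht : 0 < t) :
    HasDerivAt (fun t => (iterSemigroup Q (n + 1) t 1 x).toReal)
      ((∑' z, (Q x z : ℝ) * (iterSemigroup Q n t 1 z).toReal) -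
        totalRate Q x * (iterSemigroup Q (n + 1) t 1 x).toReal) t :=
  renewal_hasDerivAt (x := x) (u₀ := 1) (C := 1) hQ (measurable_iterSemigroup Q n 1)
    (fun s hs z => by simpa using hQ.iterSemigroup_one_le n hs z)
    (fun t _ => by rw [iterSemigroup_succ]; simp) (hQ.iterSemigroup_one_continuousOn n) ht

theorem IsRegular.tendsto_iterSemigroup_one [Countable E] (hQ : IsRegular Q) {t : ℝ}
    (ht : 0 ≤ t) (x : E) :
    Filter.Tendsto (fun n => (iterSemigroup Q n t 1 x).toReal) Filter.atTop (nhds 1) := by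
  have h := tendsto_atTop_iSup (iterSemigroup_mono Q t 1 x)
  rw [← semigroupNonneg_eq_iSup] at h
  have h1 : semigroupNonneg Q t 1 x = 1 := by simp [semigroupNonneg, hQ.honest t ht x]
  rw [h1] at h
  exact (ENNReal.tendsto_toReal ENNReal.one_ne_top).comp h

/-- Bounded supersolutions of the backward equation with non-negative initial value are
non-negative. By induction on `n`, `V ≥ -C (1 - p_n)`, where `p_n` is the probability of fewer than
`n` jumps; non-explosion gives `p_n → 1`. -/
theorem IsRegular.nonneg_of_supersolution [Countable E] (hQ : IsRegular Q) {V V' : ℝ → E → ℝ}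
    {C T : ℝ} (hb : ∀ t ∈ Set.Icc 0 T, ∀ x, |V t x| ≤ C)
    (hc : ∀ x, ContinuousOn (fun t => V t x) (Set.Icc 0 T))
    (hd : ∀ t ∈ Set.Ioo 0 T, ∀ x, HasDerivAt (fun t => V t x) (V' t x) t)
    (hV' : ∀ t ∈ Set.Ioo 0 T, ∀ x, generator Q (V t) x ≤ V' t x)
    (h0 : ∀ x, 0 ≤ V 0 x) {t : ℝ} (ht : t ∈ Set.Icc 0 T) (x : E) : 0 ≤ V t x := by
  have hT : 0 ≤ T := ht.1.trans ht.2
  set N : ℕ → ℝ → E → ℝ := fun n t x => (iterSemigroup Q n t 1 x).toReal with hN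
  have hN1 : ∀ n, ∀ t, 0 ≤ t → ∀ x, |N n t x| ≤ 1 := fun n t ht x => by
    rw [hN, abs_of_nonneg ENNReal.toReal_nonneg]
    exact ENNReal.toReal_le_of_le_ofReal zero_le_one (by simpa using hQ.iterSemigroup_one_le n ht x)
  have hC : 0 ≤ C := (abs_nonneg _).trans (hb t ht x)
  have key : ∀ n, ∀ t ∈ Set.Icc 0 T, ∀ x, 0 ≤ V t x + C * (1 - N n t x) := by
    intro n
    induction n with
    | zero =>
      intro t ht x
      simp only [hN, iterSemigroup, transIter, mul_zero, tsum_zero, ENNReal.toReal_zero]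
      linarith [(abs_le.1 (hb t ht x)).1]
    | succ n ih =>
      intro t ht x
      set q := totalRate Q x
      have hexp : ∀ s : ℝ, HasDerivAt (fun s => Real.exp (q * s)) (Real.exp (q * s) * (q * 1)) s :=
        fun s => ((hasDerivAt_id s).const_mul q).exp
      have hder : ∀ s ∈ Set.Ioo 0 T, HasDerivAt
          (fun s => Real.exp (q * s) * (V s x + C * (1 - N (n + 1) s x)))
          (Real.exp (q * s) * (q * 1) * (V s x + C * (1 - N (n + 1) s x)) + Real.exp (q * s) *
            (V' s x + C * (-((∑' z, (Q x z : ℝ) * N n s z) - q * N (n + 1) s x)))) s := fun s hs =>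
        (hexp s).mul ((hd s hs x).add
          (((hQ.iterSemigroup_one_hasDerivAt n x hs.1).const_sub 1).const_mul C))
      -- `s ↦ e^{q s} (V + C (1 - p_{n+1}))` has derivative at least
      -- `e^{q s} ∑_z Q(x, z) (V + C (1 - p_n))(z)`, which is non-negative by induction.
      have hmono : MonotoneOn (fun s => Real.exp (q * s) * (V s x + C * (1 - N (n + 1) s x)))
          (Set.Icc 0 T) := by
        refine monotoneOn_of_deriv_nonneg (convex_Icc 0 T) ?_ ?_ ?_
        · exact ContinuousOn.mul (by fun_prop) ((hc x).add (continuousOn_const.mul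
            (continuousOn_const.sub (hQ.iterSemigroup_one_continuousOn (n + 1) x T))))
        · rw [interior_Icc]
          exact fun s hs => (hder s hs).differentiableAt.differentiableWithinAt
        · rw [interior_Icc]
          intro s hs
          have hsI := Set.Ioo_subset_Icc_self hs
          rw [(hder s hs).deriv]
          have hgen := hV' s hs x
          rw [hQ.generator_eq x (hb s hsI)] at hgen
          have hsV := hQ.summable_mul x (hb s hsI)
          have hsN := hQ.summable_mul x (hN1 n s hs.1.le)
          have hpos : 0 ≤ ∑' z, (Q x z : ℝ) * (V s z + C * (1 - N n s z)) :=
            tsum_nonneg fun z => mul_nonneg (Q x z).2 (ih s hsI z)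
          have hexpand : ∑' z, (Q x z : ℝ) * (V s z + C * (1 - N n s z)) =
              (∑' z, (Q x z : ℝ) * V s z) + C * q - C * ∑' z, (Q x z : ℝ) * N n s z := by
            have hq : C * q = ∑' z, C * (Q x z : ℝ) := tsum_mul_left.symm
            rw [hq, ← tsum_mul_left,
              ← hsV.tsum_add ((hQ.summable_coe x).mul_left C),
              ← (hsV.add ((hQ.summable_coe x).mul_left C)).tsum_sub (hsN.mul_left C)]
            exact tsum_congr fun z => by ring
          rw [hexpand] at hpos
          have : 0 ≤ Real.exp (q * s) * (V' s x + q * V s x + C * q -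
              C * ∑' z, (Q x z : ℝ) * N n s z) :=
            mul_nonneg (Real.exp_pos _).le (by linarith)
          linarith
      have h := hmono (Set.left_mem_Icc.2 hT) ht ht.1
      have hN0 : N (n + 1) 0 x = 1 := by simp [hN, iterSemigroup_one_at_zero]
      simp only [hN0, mul_zero, Real.exp_zero, sub_self, one_mul, add_zero] at h
      exact nonneg_of_mul_nonneg_right ((h0 x).trans h) (Real.exp_pos _)
  have hlim : Filter.Tendsto (fun n => V t x + C * (1 - N n t x)) Filter.atTop
      (nhds (V t x + C * (1 - 1))) :=
    ((((hQ.tendsto_iterSemigroup_one ht.1 x).const_sub 1).const_mul C).const_add _)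
  simpa using ge_of_tendsto' hlim fun n => key n t ht x

end Comparison

/-! ### Covariance inequality under the curvature bound -/

section Covariance

theorem IsRegular.carre_eq (hQ : IsRegular Q) {a : E → ℝ} {C : ℝ} (ha : ∀ z, |a z| ≤ C) (x : E) :
    carre Q a x = ENNReal.ofReal (2⁻¹ * ∑' z, (Q x z : ℝ) * (a z - a x) ^ 2) := by
  have hs : Summable fun z => (Q x z : ℝ) * (a z - a x) ^ 2 :=
    hQ.summable_mul x (C := (C + C) ^ 2) fun z => by
      rw [abs_pow]
      gcongr
      exact (abs_sub _ _).trans (add_le_add (ha z) (ha x))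
  rw [carre, ENNReal.ofReal_mul (by norm_num), ENNReal.ofReal_inv_of_pos (by norm_num),
    ENNReal.ofReal_ofNat, ENNReal.ofReal_tsum_of_nonneg
      (fun z => mul_nonneg (Q x z).coe_nonneg (sq_nonneg _)) hs]
  congr 1
  refine tsum_congr fun z => ?_
  rw [ENNReal.ofReal_mul (Q x z).coe_nonneg, ENNReal.ofReal_coe_nnreal, mul_comm]

theorem IsRegular.tsum_sq_le (hQ : IsRegular Q) {a : E → ℝ} {C α : ℝ} (ha : ∀ z, |a z| ≤ C)
    (hα : 0 ≤ α) {x : E} (h : carre Q a x ^ (1 / 2 : ℝ) ≤ ENNReal.ofReal α) :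
    ∑' z, (Q x z : ℝ) * (a z - a x) ^ 2 ≤ 2 * α ^ 2 := by
  have h2 : carre Q a x ≤ ENNReal.ofReal (α ^ 2) := by
    have := ENNReal.rpow_le_rpow h (z := 2) (by norm_num)
    rw [← ENNReal.rpow_mul] at this
    norm_num at this
    rwa [ENNReal.ofReal_pow hα]
  rw [hQ.carre_eq ha, ENNReal.ofReal_le_ofReal_iff (by positivity)] at h2
  linarith

/-- The Cauchy-Schwarz inequality `2 Γ(a, b) ≤ 2 Γ(a)^{1/2} Γ(b)^{1/2}`. -/
theorem IsRegular.carre_cauchySchwarz (hQ : IsRegular Q) {a b : E → ℝ} {C D α β : ℝ}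
    (ha : ∀ z, |a z| ≤ C) (hb : ∀ z, |b z| ≤ D) (hα : 0 ≤ α) (hβ : 0 ≤ β) {x : E}
    (h1 : carre Q a x ^ (1 / 2 : ℝ) ≤ ENNReal.ofReal α)
    (h2 : carre Q b x ^ (1 / 2 : ℝ) ≤ ENNReal.ofReal β) :
    ∑' z, (Q x z : ℝ) * ((a z - a x) * (b z - b x)) ≤ 2 * α * β := by
  have h1' := hQ.tsum_sq_le ha hα h1
  have h2' := hQ.tsum_sq_le hb hβ h2
  have da : ∀ z, |a z - a x| ≤ C + C := fun z => (abs_sub _ _).trans (add_le_add (ha z) (ha x))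
  have db : ∀ z, |b z - b x| ≤ D + D := fun z => (abs_sub _ _).trans (add_le_add (hb z) (hb x))
  have hC := (abs_nonneg _).trans (da x)
  have hD := (abs_nonneg _).trans (db x)
  have sa : Summable fun z => (Q x z : ℝ) * (a z - a x) ^ 2 :=
    hQ.summable_mul x (C := (C + C) ^ 2) fun z => by rw [abs_pow]; gcongr; exact da z
  have sb : Summable fun z => (Q x z : ℝ) * (b z - b x) ^ 2 :=
    hQ.summable_mul x (C := (D + D) ^ 2) fun z => by rw [abs_pow]; gcongr; exact db z
  have sab : Summable fun z => (Q x z : ℝ) * ((a z - a x) * (b z - b x)) :=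
    hQ.summable_mul x (C := (C + C) * (D + D)) fun z => by
      rw [abs_mul]; exact mul_le_mul (da z) (db z) (abs_nonneg _) hC
  set SA := ∑' z, (Q x z : ℝ) * (a z - a x) ^ 2
  set SB := ∑' z, (Q x z : ℝ) * (b z - b x) ^ 2
  set S := ∑' z, (Q x z : ℝ) * ((a z - a x) * (b z - b x))
  have hSA : 0 ≤ SA := tsum_nonneg fun z => mul_nonneg (Q x z).2 (sq_nonneg _)
  have hSB : 0 ≤ SB := tsum_nonneg fun z => mul_nonneg (Q x z).2 (sq_nonneg _)
  have hdisc : discrim SB (2 * S) SA ≤ 0 := by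
    refine discrim_le_zero fun s => ?_
    have : SB * (s * s) + 2 * S * s + SA =
        ∑' z, (Q x z : ℝ) * ((a z - a x) + s * (b z - b x)) ^ 2 := by
      rw [show SB * (s * s) + 2 * S * s + SA = (s * s) * SB + (2 * s) * S + SA by ring,
        ← tsum_mul_left, ← tsum_mul_left, ← (sb.mul_left _).tsum_add (sab.mul_left _),
        ← ((sb.mul_left _).add (sab.mul_left _)).tsum_add sa]
      exact tsum_congr fun z => by ring
    rw [this]
    exact tsum_nonneg fun z => mul_nonneg (Q x z).2 (sq_nonneg _)
  rw [discrim] at hdisc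
  have hS2 : S ^ 2 ≤ SA * SB := by linarith
  have hprod : SA * SB ≤ (2 * α ^ 2) * (2 * β ^ 2) := mul_le_mul h1' h2' hSB (by positivity)
  exact le_of_sq_le_sq (by nlinarith) (by positivity)

theorem IsRegular.generator_mul (hQ : IsRegular Q) {a b : E → ℝ} {C D : ℝ}
    (ha : ∀ z, |a z| ≤ C) (hb : ∀ z, |b z| ≤ D) (x : E) :
    generator Q (fun z => a z * b z) x = a x * generator Q b x + b x * generator Q a x +
      ∑' z, (Q x z : ℝ) * ((a z - a x) * (b z - b x)) := by
  have da : ∀ z, |a z - a x| ≤ C + C := fun z => (abs_sub _ _).trans (add_le_add (ha z) (ha x))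
  have db : ∀ z, |b z - b x| ≤ D + D := fun z => (abs_sub _ _).trans (add_le_add (hb z) (hb x))
  have sa := (hQ.summable_mul x da).mul_left (b x)
  have sb := (hQ.summable_mul x db).mul_left (a x)
  have sab : Summable fun z => (Q x z : ℝ) * ((a z - a x) * (b z - b x)) :=
    hQ.summable_mul x (C := (C + C) * (D + D)) fun z => by
      rw [abs_mul]; exact mul_le_mul (da z) (db z) (abs_nonneg _) ((abs_nonneg _).trans (da x))
  simp only [generator]
  rw [← tsum_mul_left, ← tsum_mul_left, ← sb.tsum_add sa, ← (sb.add sa).tsum_add sab]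
  exact tsum_congr fun z => by ring

theorem curvTime_zero (ρ : ℝ) : curvTime 0 ρ = 0 := by simp [curvTime]

theorem curvTime_hasDerivAt (ρ t : ℝ) :
    HasDerivAt (fun t => curvTime t ρ) (Real.exp (-(2 * ρ * t))) t := by
  by_cases h : ρ = 0
  · simp only [curvTime, h, if_true]
    simpa using hasDerivAt_id' t
  · simp only [curvTime, h, if_false]
    have h1 : HasDerivAt (fun t => Real.exp (-(2 * ρ * t)))
        (Real.exp (-(2 * ρ * t)) * (-(2 * ρ * 1))) t :=
      (((hasDerivAt_id t).const_mul _).neg).exp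
    refine ((h1.const_sub 1).div_const (2 * ρ)).congr_deriv ?_
    field_simp

theorem curvTime_strictMono (ρ : ℝ) : StrictMono fun t => curvTime t ρ :=
  strictMono_of_deriv_pos fun t => by
    rw [(curvTime_hasDerivAt ρ t).deriv]
    exact Real.exp_pos _

theorem curvTime_pos {t : ℝ} (ht : 0 < t) (ρ : ℝ) : 0 < curvTime t ρ := by
  simpa [curvTime_zero] using curvTime_strictMono ρ ht

/-- The covariance of `u` and `v` under `P_t` solves `∂_t D = L D + 2 Γ(P_t u, P_t v)` with `D_0 = 0`,
and the curvature bound makes `2 A κ L_{t,ρ} P_t w` a supersolution of this equation. -/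
theorem IsRegular.covariance_le [Countable E] (hQ : IsRegular Q) {𝒜 : Subalgebra ℝ (E → ℝ)}
    (h𝒜 : ∀ g : E → ℝ, (∃ C : ℝ, ∀ x, |g x| ≤ C) → g ∈ 𝒜) {ρ : ℝ} (hρ : GammaCurvatureGE Q 𝒜 ρ)
    {u v w : E → ℝ} {Cu Cv Cw A κ : ℝ} (hu : ∀ y, |u y| ≤ Cu) (hv : ∀ y, |v y| ≤ Cv)
    (hw : ∀ y, |w y| ≤ Cw) (hw0 : ∀ y, 0 ≤ w y) (hA : 0 ≤ A) (hκ : 0 ≤ κ)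
    (hΓu : ∀ y, carre Q u y ^ (1 / 2 : ℝ) ≤ ENNReal.ofReal A)
    (hΓv : ∀ y, carre Q v y ^ (1 / 2 : ℝ) ≤ ENNReal.ofReal (κ * w y))
    {t : ℝ} (ht : 0 ≤ t) (x : E) :
    semigroup Q t (fun y => u y * v y) x - semigroup Q t u x * semigroup Q t v x ≤
      2 * A * κ * curvTime t ρ * semigroup Q t w x := by
  have huv : ∀ y, |u y * v y| ≤ Cu * Cv := fun y => by
    rw [abs_mul]; exact mul_le_mul (hu y) (hv y) (abs_nonneg _) ((abs_nonneg _).trans (hu y))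
  have hκw : ∀ y, |κ * w y| ≤ κ * Cw := fun y => by
    rw [abs_mul, abs_of_nonneg hκ]; exact mul_le_mul_of_nonneg_left (hw y) hκ
  have hPw0 : ∀ r y, 0 ≤ semigroup Q r w y := fun r y =>
    tsum_nonneg fun y => mul_nonneg (hw0 y) ENNReal.toReal_nonneg
  set a := fun r => semigroup Q r u
  set b := fun r => semigroup Q r v
  set W := fun r => semigroup Q r w
  set G := fun r => semigroup Q r fun y => u y * v y
  have hba : ∀ r, 0 ≤ r → ∀ y, |a r y| ≤ Cu := fun r hr y => hQ.abs_semigroup_le hr y hu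
  have hbb : ∀ r, 0 ≤ r → ∀ y, |b r y| ≤ Cv := fun r hr y => hQ.abs_semigroup_le hr y hv
  have hbW : ∀ r, 0 ≤ r → ∀ y, |W r y| ≤ Cw := fun r hr y => hQ.abs_semigroup_le hr y hw
  have hbG : ∀ r, 0 ≤ r → ∀ y, |G r y| ≤ Cu * Cv := fun r hr y => hQ.abs_semigroup_le hr y huv
  have hΓa : ∀ r, 0 < r → ∀ y, carre Q (a r) y ^ (1 / 2 : ℝ) ≤
      ENNReal.ofReal (Real.exp (-(ρ * r)) * A) := fun r hr y => by
    refine (hρ u (h𝒜 u ⟨Cu, hu⟩) r hr (fun y => hQ.summable_semigroup hr.le y hu) y).trans ?_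
    rw [ENNReal.ofReal_mul (Real.exp_pos _).le]
    gcongr
    exact hQ.semigroupNonneg_le hr.le y hΓu
  have hΓb : ∀ r, 0 < r → ∀ y, carre Q (b r) y ^ (1 / 2 : ℝ) ≤
      ENNReal.ofReal (Real.exp (-(ρ * r)) * (κ * W r y)) := fun r hr y => by
    refine (hρ v (h𝒜 v ⟨Cv, hv⟩) r hr (fun y => hQ.summable_semigroup hr.le y hv) y).trans ?_
    rw [ENNReal.ofReal_mul (Real.exp_pos _).le]
    gcongr
    calc semigroupNonneg Q r (fun z => carre Q v z ^ (1 / 2 : ℝ)) y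
        ≤ semigroupNonneg Q r (fun z => ENNReal.ofReal (κ * w z)) y :=
          ENNReal.tsum_le_tsum fun z => mul_le_mul_left (hΓv z) _
      _ = ENNReal.ofReal (κ * W r y) := by
          rw [hQ.semigroupNonneg_ofReal hr.le y hκw fun z => mul_nonneg hκ (hw0 z)]
          simp only [W, semigroup, mul_assoc, tsum_mul_left]
  set K := 2 * A * κ
  have hK : 0 ≤ K := by positivity
  have hL0 : ∀ r, 0 ≤ r → 0 ≤ curvTime r ρ := fun r hr => by
    simpa [curvTime_zero] using (curvTime_strictMono ρ).monotone hr
  have hLt : ∀ r ≤ t, curvTime r ρ ≤ curvTime t ρ := fun r hr => (curvTime_strictMono ρ).monotone hr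
  suffices h : 0 ≤ K * curvTime t ρ * W t x - (G t x - a t x * b t x) by linarith
  refine hQ.nonneg_of_supersolution (T := t)
    (V := fun r y => K * curvTime r ρ * W r y - (G r y - a r y * b r y))
    (V' := fun r y => (K * Real.exp (-(2 * ρ * r)) * W r y +
      K * curvTime r ρ * generator Q (W r) y) - (generator Q (G r) y -
      (generator Q (a r) y * b r y + a r y * generator Q (b r) y)))
    (C := K * curvTime t ρ * Cw + (Cu * Cv + Cu * Cv)) ?_ ?_ ?_ ?_ ?_ (Set.right_mem_Icc.2 ht) x
  · intro r hr y
    refine (abs_sub _ _).trans (add_le_add ?_ ((abs_sub _ _).trans (add_le_add (hbG r hr.1 y) ?_)))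
    · rw [abs_mul, abs_mul, abs_of_nonneg hK, abs_of_nonneg (hL0 r hr.1)]
      exact mul_le_mul (mul_le_mul_of_nonneg_left (hLt r hr.2) hK) (hbW r hr.1 y) (abs_nonneg _)
        (mul_nonneg hK (hL0 t ht))
    · rw [abs_mul]
      exact mul_le_mul (hba r hr.1 y) (hbb r hr.1 y) (abs_nonneg _)
        ((abs_nonneg _).trans (hba r hr.1 y))
  · intro y
    have hcL : ContinuousOn (fun r => curvTime r ρ) (Set.Icc 0 t) := fun r _ =>
      (curvTime_hasDerivAt ρ r).continuousAt.continuousWithinAt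
    exact ((continuousOn_const.mul hcL).mul (hQ.semigroup_continuousOn hw y t)).sub
      ((hQ.semigroup_continuousOn huv y t).sub
        ((hQ.semigroup_continuousOn hu y t).mul (hQ.semigroup_continuousOn hv y t)))
  · intro r hr y
    exact (((curvTime_hasDerivAt ρ r).const_mul K).mul (hQ.semigroup_hasDerivAt hw y hr.1)).sub
      ((hQ.semigroup_hasDerivAt huv y hr.1).sub
        ((hQ.semigroup_hasDerivAt hu y hr.1).mul (hQ.semigroup_hasDerivAt hv y hr.1)))
  · intro r hr y
    -- The difference of the two sides is `K e^{-2ρr} P_r w - 2 Γ(P_r u, P_r v)`.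
    have hlin : generator Q (fun y => K * curvTime r ρ * W r y - (G r y - a r y * b r y)) y =
        K * curvTime r ρ * generator Q (W r) y -
          (generator Q (G r) y - generator Q (fun z => a r z * b r z) y) := by
      have hd : ∀ {g : E → ℝ} {c : ℝ}, (∀ z, |g z| ≤ c) →
          Summable fun z => (Q y z : ℝ) * (g z - g y) := fun {g c} hg =>
        hQ.summable_mul y (C := c + c) fun z => (abs_sub _ _).trans (add_le_add (hg z) (hg y))
      have hab : ∀ z, |a r z * b r z| ≤ Cu * Cv := fun z => by
        rw [abs_mul]
        exact mul_le_mul (hba r hr.1.le z) (hbb r hr.1.le z) (abs_nonneg _)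
          ((abs_nonneg _).trans (hba r hr.1.le z))
      simp only [generator]
      rw [← (hd (hbG r hr.1.le)).tsum_sub (hd hab), ← tsum_mul_left,
        ← ((hd (hbW r hr.1.le)).mul_left _).tsum_sub ((hd (hbG r hr.1.le)).sub (hd hab))]
      exact tsum_congr fun z => by ring
    rw [hlin, hQ.generator_mul (hba r hr.1.le) (hbb r hr.1.le)]
    have hcs := hQ.carre_cauchySchwarz (hba r hr.1.le) (hbb r hr.1.le) (by positivity)
      (mul_nonneg (Real.exp_pos _).le (mul_nonneg hκ (hPw0 r y))) (hΓa r hr.1 y) (hΓb r hr.1 y)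
    have hexp : Real.exp (-(2 * ρ * r)) = Real.exp (-(ρ * r)) * Real.exp (-(ρ * r)) := by
      rw [← Real.exp_add]; congr 1; ring
    have : K * Real.exp (-(2 * ρ * r)) * W r y =
        2 * (Real.exp (-(ρ * r)) * A) * (Real.exp (-(ρ * r)) * (κ * W r y)) := by
      rw [hexp]; ring
    linarith
  · intro y
    simp only [curvTime_zero, a, b, G, semigroup_zero hQ hu, semigroup_zero hQ hv,
      semigroup_zero hQ huv]
    simp

end Covariance

/-! ### Truncation and moment bounds -/

/-- Truncation of a real number to the interval `[-n, n]`. -/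
def clamp (n : ℕ) (r : ℝ) : ℝ := max (-(n : ℝ)) (min r n)

theorem abs_clamp_le (n : ℕ) (r : ℝ) : |clamp n r| ≤ n :=
  abs_le.2 ⟨le_max_left _ _, max_le (by simp) (min_le_right _ _)⟩

theorem abs_clamp_sub_le (n : ℕ) (r s : ℝ) : |clamp n r - clamp n s| ≤ |r - s| := by
  rw [clamp, clamp, max_comm, max_comm (-(n : ℝ))]
  refine (abs_max_sub_max_le_abs _ _ _).trans ((abs_min_sub_min_le_max r n s n).trans ?_)
  simp

theorem abs_clamp_le_abs (n : ℕ) (r : ℝ) : |clamp n r| ≤ |r| := by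
  have : clamp n 0 = 0 := by simp [clamp]
  simpa [this] using abs_clamp_sub_le n r 0

theorem clamp_le_max (n : ℕ) (r : ℝ) : clamp n r ≤ max r 0 := by
  rw [clamp, max_le_iff]
  exact ⟨le_max_of_le_right (by simp), (min_le_left _ _).trans (le_max_left _ _)⟩

theorem measurable_clamp (n : ℕ) : Measurable (clamp n) := by
  unfold clamp; fun_prop

theorem tendsto_clamp (r : ℝ) : Filter.Tendsto (fun n => clamp n r) Filter.atTop (nhds r) := by
  obtain ⟨N, hN⟩ := exists_nat_ge |r|
  refine tendsto_const_nhds.congr' ?_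
  filter_upwards [Filter.eventually_ge_atTop N] with n hn
  have h : |r| ≤ n := hN.trans (by exact_mod_cast hn)
  rw [clamp, min_eq_left (abs_le.1 h).2, max_eq_right (abs_le.1 h).1]

section Moments

variable {Ω : Type*} {m : MeasurableSpace Ω} {P : Measure Ω} [IsProbabilityMeasure P] {Y : Ω → ℝ}

theorem integrable_of_abs_le {Z : Ω → ℝ} (hZ : Measurable Z) {c : ℝ} (h : ∀ ω, |Z ω| ≤ c) :
    Integrable Z P :=
  Integrable.of_bound hZ.aestronglyMeasurable c (Filter.Eventually.of_forall h)

/-- If the truncations of `Y` have uniformly bounded variances, then `Y` is integrable. With an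
independent copy `Y'` of `Y`, Fatou's lemma gives `E (Y - Y')² < ∞`, so that `Y - c` is square
integrable for some constant `c`; no a priori bound on the means of the truncations is needed. -/
theorem integrable_of_variance_clamp_le (hY : Measurable Y) {V : ℝ}
    (hV : ∀ n, ∫ ω, clamp n (Y ω) * clamp n (Y ω) ∂P -
      (∫ ω, clamp n (Y ω) ∂P) * (∫ ω, clamp n (Y ω) ∂P) ≤ V) : Integrable Y P := by
  set Z : ℕ → Ω → ℝ := fun n ω => clamp n (Y ω)
  have hZm : ∀ n, Measurable (Z n) := fun n => (measurable_clamp n).comp hY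
  have hZb : ∀ n ω, |Z n ω| ≤ n := fun n ω => abs_clamp_le n _
  have hZi : ∀ n, Integrable (Z n) P := fun n => integrable_of_abs_le (hZm n) (hZb n)
  have hZZi : ∀ n, Integrable (fun ω => Z n ω * Z n ω) P := fun n =>
    integrable_of_abs_le ((hZm n).mul (hZm n)) (c := n * n) fun ω => by
      rw [abs_mul]; exact mul_le_mul (hZb n ω) (hZb n ω) (abs_nonneg _) (Nat.cast_nonneg _)
  have hsq : ∀ n ω' , Integrable (fun ω => (Z n ω - Z n ω') ^ 2) P := fun n ω' => by
    have : Integrable (fun ω => Z n ω * Z n ω - 2 * Z n ω' * Z n ω + Z n ω' ^ 2) P :=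
      ((hZZi n).sub ((hZi n).const_mul _)).add (integrable_const _)
    exact this.congr (Filter.Eventually.of_forall fun ω => by ring)
  have hinner : ∀ n ω', ∫ ω, (Z n ω - Z n ω') ^ 2 ∂P =
      (∫ ω, Z n ω * Z n ω ∂P) - 2 * Z n ω' * (∫ ω, Z n ω ∂P) + Z n ω' * Z n ω' := fun n ω' => by
    have h : ∀ ω, (Z n ω - Z n ω') ^ 2 =
        Z n ω * Z n ω - 2 * Z n ω' * Z n ω + Z n ω' * Z n ω' := fun ω => by ring
    simp_rw [h]
    have hd : Integrable (fun ω => Z n ω * Z n ω - 2 * Z n ω' * Z n ω) P :=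
      (hZZi n).sub ((hZi n).const_mul _)
    rw [integral_add hd (integrable_const _), integral_sub (hZZi n) ((hZi n).const_mul _), integral_const_mul]
    simp
  -- For independent copies, `E (Y_n - Y_n')² = 2 Var Y_n`.
  have hprod : ∀ n, ∫⁻ ω', ∫⁻ ω, ENNReal.ofReal ((Z n ω - Z n ω') ^ 2) ∂P ∂P ≤
      ENNReal.ofReal (2 * V) := fun n => by
    have h1 : ∀ ω', ∫⁻ ω, ENNReal.ofReal ((Z n ω - Z n ω') ^ 2) ∂P =
        ENNReal.ofReal ((∫ ω, Z n ω * Z n ω ∂P) - 2 * Z n ω' * (∫ ω, Z n ω ∂P) +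
          Z n ω' * Z n ω') := fun ω' => by
      rw [← hinner, ofReal_integral_eq_lintegral_ofReal (hsq n ω')
        (Filter.Eventually.of_forall fun ω => sq_nonneg _)]
    simp_rw [h1]
    have hi1 : Integrable (fun ω' => 2 * Z n ω' * (∫ ω, Z n ω ∂P)) P :=
      ((hZi n).const_mul 2).mul_const _
    have hi0 : Integrable (fun ω' => (∫ ω, Z n ω * Z n ω ∂P) - 2 * Z n ω' * (∫ ω, Z n ω ∂P)) P :=
      (integrable_const _).sub hi1
    have hi2 : Integrable (fun ω' => (∫ ω, Z n ω * Z n ω ∂P) - 2 * Z n ω' * (∫ ω, Z n ω ∂P) +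
        Z n ω' * Z n ω') P := hi0.add (hZZi n)
    rw [← ofReal_integral_eq_lintegral_ofReal hi2]
    · refine ENNReal.ofReal_le_ofReal ?_
      have h2 : ∫ ω', (((∫ ω, Z n ω * Z n ω ∂P) - 2 * Z n ω' * (∫ ω, Z n ω ∂P)) +
          Z n ω' * Z n ω') ∂P = 2 * ((∫ ω, Z n ω * Z n ω ∂P) -
            (∫ ω, Z n ω ∂P) * (∫ ω, Z n ω ∂P)) := by
        rw [integral_add hi0 (hZZi n),
          integral_sub (integrable_const _) hi1, integral_mul_const, integral_const_mul]
        simp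
        ring
      exact h2.le.trans (by linarith [hV n])
    · refine Filter.Eventually.of_forall fun ω' => ?_
      simp only [Pi.zero_apply]
      exact (hinner n ω').symm ▸ integral_nonneg fun ω => sq_nonneg _
  have hmeas2 : ∀ n, Measurable (Function.uncurry fun ω' ω =>
      ENNReal.ofReal ((Z n ω - Z n ω') ^ 2)) := fun n =>
    ((((hZm n).comp measurable_snd).sub ((hZm n).comp measurable_fst)).pow_const 2).ennreal_ofReal
  have hlim : ∀ ω' ω, ENNReal.ofReal ((Y ω - Y ω') ^ 2) =
      Filter.liminf (fun n => ENNReal.ofReal ((Z n ω - Z n ω') ^ 2)) Filter.atTop :=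
    fun ω' ω => (((ENNReal.continuous_ofReal.tendsto _).comp
      (((tendsto_clamp (Y ω)).sub (tendsto_clamp (Y ω'))).pow 2)).liminf_eq).symm
  have hfin : ∫⁻ ω', ∫⁻ ω, ENNReal.ofReal ((Y ω - Y ω') ^ 2) ∂P ∂P ≤ ENNReal.ofReal (2 * V) := by
    simp_rw [hlim]
    calc _ ≤ ∫⁻ ω', Filter.liminf (fun n => ∫⁻ ω, ENNReal.ofReal ((Z n ω - Z n ω') ^ 2) ∂P)
          Filter.atTop ∂P := lintegral_mono fun ω' =>
            lintegral_liminf_le fun n => (hmeas2 n).of_uncurry_left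
      _ ≤ Filter.liminf (fun n => ∫⁻ ω', ∫⁻ ω, ENNReal.ofReal ((Z n ω - Z n ω') ^ 2) ∂P ∂P)
          Filter.atTop := lintegral_liminf_le fun n => (hmeas2 n).lintegral_prod_right'
      _ ≤ ENNReal.ofReal (2 * V) := by
          refine (Filter.liminf_le_liminf (Filter.Eventually.of_forall hprod)).trans ?_
          simp
  have hmeas : Measurable (Function.uncurry fun ω' ω => ENNReal.ofReal ((Y ω - Y ω') ^ 2)) :=
    (((hY.comp measurable_snd).sub (hY.comp measurable_fst)).pow_const 2).ennreal_ofReal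
  obtain ⟨ω', hω'⟩ := (ae_lt_top (hmeas.lintegral_prod_right')
    (hfin.trans_lt ENNReal.ofReal_lt_top).ne).exists
  have hi : Integrable (fun ω => (Y ω - Y ω') ^ 2) P := by
    refine ⟨by fun_prop, ?_⟩
    rw [hasFiniteIntegral_iff_ofReal (Filter.Eventually.of_forall fun ω => sq_nonneg _)]
    exact hω'
  have hL2 : MemLp (fun ω => Y ω - Y ω') 2 P :=
    (memLp_two_iff_integrable_sq (by fun_prop)).2 hi
  have := (hL2.integrable one_le_two).add (integrable_const (Y ω'))
  exact this.congr (Filter.Eventually.of_forall fun ω => by simp)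

/-- Integration of the differential inequality `(log E e^{τ Z})' ≤ E Z + h(τ)` for a bounded
variable `Z`. -/
theorem integral_exp_sub_le_of_covariance_le {Z : Ω → ℝ} (hZ : Measurable Z) {c : ℝ}
    (hc : ∀ ω, |Z ω| ≤ c) {h : ℝ → ℝ} {l : ℝ} (hl : 0 ≤ l) (hh : IntegrableOn h (Set.Icc 0 l))
    (hcov : ∀ τ ∈ Set.Ioo 0 l, ∫ ω, Z ω * Real.exp (τ * Z ω) ∂P -
      (∫ ω, Z ω ∂P) * ∫ ω, Real.exp (τ * Z ω) ∂P ≤ h τ * ∫ ω, Real.exp (τ * Z ω) ∂P) :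
    ∫ ω, Real.exp (l * (Z ω - ∫ ω', Z ω' ∂P)) ∂P ≤ Real.exp (∫ τ in (0 : ℝ)..l, h τ) := by
  have hexp : ∀ τ, Integrable (fun ω => Real.exp (τ * Z ω)) P := fun τ => by
    refine integrable_of_abs_le (by fun_prop) (c := Real.exp (|τ| * c)) fun ω => ?_
    rw [Real.abs_exp, Real.exp_le_exp]
    calc τ * Z ω ≤ |τ * Z ω| := le_abs_self _
      _ ≤ |τ| * c := by rw [abs_mul]; exact mul_le_mul_of_nonneg_left (hc ω) (abs_nonneg _)
  have hset : ∀ τ, τ ∈ interior (integrableExpSet Z P) := fun τ => by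
    rw [show integrableExpSet Z P = Set.univ from Set.eq_univ_of_forall hexp, interior_univ]
    trivial
  have hpos : ∀ τ, 0 < mgf Z P τ := fun τ => mgf_pos (hexp τ)
  have hint : IntegrableOn (fun τ => h τ + ∫ ω, Z ω ∂P) (Set.Icc 0 l) :=
    hh.add (integrableOn_const (by simp))
  have hmain := intervalIntegral.sub_le_integral_of_hasDeriv_right_of_le (g := cgf Z P)
    (g' := deriv (cgf Z P)) (φ := fun τ => h τ + ∫ ω, Z ω ∂P) hl
    (fun τ _ => (analyticAt_cgf (hset τ)).continuousAt.continuousWithinAt)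
    (fun τ _ => (analyticAt_cgf (hset τ)).differentiableAt.hasDerivAt.hasDerivWithinAt) hint
    (fun τ hτ => by
      rw [deriv_cgf (hset τ), div_le_iff₀ (hpos τ)]
      have := hcov τ hτ
      rw [mgf]
      linarith)
  have hhi : IntervalIntegrable h volume 0 l :=
    (intervalIntegrable_iff_integrableOn_Icc_of_le hl).2 hh
  rw [cgf_zero, sub_zero, intervalIntegral.integral_add hhi (by simp),
    intervalIntegral.integral_const, sub_zero, smul_eq_mul] at hmain
  have hfac : ∀ ω, Real.exp (l * (Z ω - ∫ ω', Z ω' ∂P)) =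
      Real.exp (l * Z ω) * Real.exp (-(l * ∫ ω', Z ω' ∂P)) := fun ω => by
    rw [← Real.exp_add]; congr 1; ring
  simp_rw [hfac]
  rw [integral_mul_const]
  change mgf Z P l * _ ≤ _
  rw [← exp_cgf (hexp l), ← Real.exp_add, Real.exp_le_exp]
  linarith

theorem tendsto_integral_clamp {P : Measure Ω} (hY : Measurable Y) (hYi : Integrable Y P) :
    Filter.Tendsto (fun n => ∫ ω, clamp n (Y ω) ∂P) Filter.atTop (nhds (∫ ω, Y ω ∂P)) :=
  tendsto_integral_of_dominated_convergence (fun ω => |Y ω|)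
    (fun n => ((measurable_clamp n).comp hY).aestronglyMeasurable) hYi.abs
    (fun n => Filter.Eventually.of_forall fun _ => abs_clamp_le_abs n _)
    (Filter.Eventually.of_forall fun _ => tendsto_clamp _)

/-- Fatou's lemma passes a bound on the centred exponential moments of the truncations to the
limit. -/
theorem exp_moment_of_clamp (hY : Measurable Y) (hYi : Integrable Y P) {l B : ℝ}
    (hB : ∀ n, ∫ ω, Real.exp (l * (clamp n (Y ω) - ∫ ω', clamp n (Y ω') ∂P)) ∂P ≤ B) :
    Integrable (fun ω => Real.exp (l * (Y ω - ∫ ω', Y ω' ∂P))) P ∧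
      ∫ ω, Real.exp (l * (Y ω - ∫ ω', Y ω' ∂P)) ∂P ≤ B := by
  set M : ℕ → ℝ := fun n => ∫ ω', clamp n (Y ω') ∂P
  have hB0 : 0 ≤ B := (integral_nonneg fun ω => (Real.exp_pos _).le).trans (hB 0)
  have hm : ∀ n, Measurable fun ω => Real.exp (l * (clamp n (Y ω) - M n)) := fun n =>
    ((((measurable_clamp n).comp hY).sub_const _).const_mul l).exp
  have hi : ∀ n, Integrable (fun ω => Real.exp (l * (clamp n (Y ω) - M n))) P := fun n => by
    refine integrable_of_abs_le (hm n) (c := Real.exp (|l| * (n + |M n|))) fun ω => ?_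
    rw [Real.abs_exp, Real.exp_le_exp]
    refine (le_abs_self _).trans ?_
    rw [abs_mul]
    exact mul_le_mul_of_nonneg_left ((abs_sub _ _).trans (by grw [abs_clamp_le])) (abs_nonneg _)
  have hlim : ∀ ω, ENNReal.ofReal (Real.exp (l * (Y ω - ∫ ω', Y ω' ∂P))) =
      Filter.liminf (fun n => ENNReal.ofReal (Real.exp (l * (clamp n (Y ω) - M n))))
        Filter.atTop := fun ω =>
    (((ENNReal.continuous_ofReal.comp Real.continuous_exp).tendsto _).comp
      (((tendsto_clamp (Y ω)).sub (tendsto_integral_clamp hY hYi)).const_mul l)).liminf_eq.symm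
  have hfin : ∫⁻ ω, ENNReal.ofReal (Real.exp (l * (Y ω - ∫ ω', Y ω' ∂P))) ∂P ≤
      ENNReal.ofReal B := by
    simp_rw [hlim]
    refine (lintegral_liminf_le fun n => (hm n).ennreal_ofReal).trans ?_
    refine (Filter.liminf_le_liminf (v := fun _ => ENNReal.ofReal B)
      (Filter.Eventually.of_forall fun n => ?_)).trans (by simp)
    rw [← ofReal_integral_eq_lintegral_ofReal (hi n)
      (Filter.Eventually.of_forall fun ω => (Real.exp_pos _).le)]
    exact ENNReal.ofReal_le_ofReal (hB n)
  have hint : Integrable (fun ω => Real.exp (l * (Y ω - ∫ ω', Y ω' ∂P))) P := by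
    refine ⟨by fun_prop, ?_⟩
    rw [hasFiniteIntegral_iff_ofReal (Filter.Eventually.of_forall fun ω => (Real.exp_pos _).le)]
    exact hfin.trans_lt ENNReal.ofReal_lt_top
  refine ⟨hint, ?_⟩
  rwa [← ofReal_integral_eq_lintegral_ofReal hint
    (Filter.Eventually.of_forall fun ω => (Real.exp_pos _).le),
    ENNReal.ofReal_le_ofReal_iff hB0] at hfin

/-- The covariance inequality for the truncations passes to `Y` at interior points of the domain
of the Laplace transform, since `|Y_n| e^{l Y_n} ≤ |Y| (e^{l Y} + 1)`. -/
theorem covariance_exp_le_of_clamp (hY : Measurable Y) (hYi : Integrable Y P) {l κ : ℝ}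
    (hl : 0 ≤ l) (hint : l ∈ interior (integrableExpSet Y P))
    (hcov : ∀ n, ∫ ω, clamp n (Y ω) * Real.exp (l * clamp n (Y ω)) ∂P -
      (∫ ω, clamp n (Y ω) ∂P) * ∫ ω, Real.exp (l * clamp n (Y ω)) ∂P ≤
        κ * ∫ ω, Real.exp (l * clamp n (Y ω)) ∂P) :
    ∫ ω, Y ω * Real.exp (l * Y ω) ∂P - (∫ ω, Y ω ∂P) * ∫ ω, Real.exp (l * Y ω) ∂P ≤
      κ * ∫ ω, Real.exp (l * Y ω) ∂P := by
  have hcm : ∀ n, Measurable fun ω => clamp n (Y ω) := fun n => (measurable_clamp n).comp hY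
  have hexpb : ∀ n ω, Real.exp (l * clamp n (Y ω)) ≤ Real.exp (l * Y ω) + 1 := fun n ω => by
    have h1 : l * clamp n (Y ω) ≤ l * max (Y ω) 0 :=
      mul_le_mul_of_nonneg_left (clamp_le_max n _) hl
    refine (Real.exp_le_exp.2 h1).trans ?_
    rcases le_total (Y ω) 0 with h | h
    · rw [max_eq_right h, mul_zero, Real.exp_zero]
      linarith [Real.exp_pos (l * Y ω)]
    · rw [max_eq_left h]
      linarith
  have hE : Integrable (fun ω => Real.exp (l * Y ω)) P :=
    interior_subset (s := integrableExpSet Y P) hint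
  have hYE : Integrable (fun ω => |Y ω| * Real.exp (l * Y ω)) P := by
    simpa using integrable_pow_abs_mul_exp_of_mem_interior_integrableExpSet hint 1
  have t1 : Filter.Tendsto (fun n => ∫ ω, Real.exp (l * clamp n (Y ω)) ∂P) Filter.atTop
      (nhds (∫ ω, Real.exp (l * Y ω) ∂P)) := by
    refine tendsto_integral_of_dominated_convergence (fun ω => Real.exp (l * Y ω) + 1)
      (fun n => ((hcm n).const_mul l).exp.aestronglyMeasurable) (hE.add (integrable_const 1))
      (fun n => Filter.Eventually.of_forall fun ω => ?_) (Filter.Eventually.of_forall fun ω => ?_)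
    · rw [Real.norm_eq_abs, Real.abs_exp]
      exact hexpb n ω
    · exact (Real.continuous_exp.tendsto _).comp ((tendsto_clamp (Y ω)).const_mul l)
  have t2 : Filter.Tendsto (fun n => ∫ ω, clamp n (Y ω) * Real.exp (l * clamp n (Y ω)) ∂P)
      Filter.atTop (nhds (∫ ω, Y ω * Real.exp (l * Y ω) ∂P)) := by
    refine tendsto_integral_of_dominated_convergence
      (fun ω => |Y ω| * Real.exp (l * Y ω) + |Y ω|)
      (fun n => ((hcm n).mul ((hcm n).const_mul l).exp).aestronglyMeasurable) (hYE.add hYi.abs)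
      (fun n => Filter.Eventually.of_forall fun ω => ?_) (Filter.Eventually.of_forall fun ω => ?_)
    · rw [norm_mul, Real.norm_eq_abs, Real.norm_eq_abs, Real.abs_exp]
      calc _ ≤ |Y ω| * (Real.exp (l * Y ω) + 1) :=
            mul_le_mul (abs_clamp_le_abs n _) (hexpb n ω) (Real.exp_pos _).le (abs_nonneg _)
        _ = _ := by ring
    · exact (tendsto_clamp (Y ω)).mul
        ((Real.continuous_exp.tendsto _).comp ((tendsto_clamp (Y ω)).const_mul l))
  exact le_of_tendsto_of_tendsto' (t2.sub ((tendsto_integral_clamp hY hYi).mul t1))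
    (t1.const_mul κ) hcov

end Moments

/-! ### The law of the chain -/

section Law

variable {Ω : Type*} {m : MeasurableSpace Ω} {ℱ : Filtration ℝ≥0 m} {Pr : E → Measure Ω}
  {X : ℝ≥0 → Ω → E}

theorem IsMarkovChain.measurable_comp [Countable E] (hX : IsMarkovChain Q ℱ Pr X) (t : ℝ≥0)
    (g : E → ℝ) : Measurable fun ω => g (X t ω) := by
  let _ : MeasurableSpace E := ⊤
  have hXm : Measurable (X t) :=
    measurable_to_countable' fun y => ℱ.le t _ (hX.adapted t y)
  exact (measurable_from_top (f := g)).comp hXm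

theorem IsMarkovChain.measure_preimage (hX : IsMarkovChain Q ℱ Pr X) (t : ℝ≥0) (x y : E) :
    Pr x (X t ⁻¹' {y}) = transProb Q t x y := by
  have := hX.prob x
  have h1 : Pr x (X 0 ⁻¹' {x}) = 1 := by
    rw [measure_eq_measure_of_null_sdiff (Set.subset_univ _), measure_univ]
    refine measure_mono_null (fun ω hω => ?_) (ae_iff.1 (hX.start x))
    simpa using hω
  have h2 := hX.markov x 0 t Set.univ MeasurableSet.univ x y
  rw [Set.univ_inter, h1, one_mul, zero_add] at h2
  rw [← h2]
  refine measure_congr ?_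
  filter_upwards [hX.start x] with ω hω
  refine propext ⟨fun h => ⟨hω, h⟩, fun h => h.2⟩

theorem IsMarkovChain.integral_eq_semigroup [Countable E] (hX : IsMarkovChain Q ℱ Pr X) (t : ℝ≥0)
    (x : E) {g : E → ℝ} {C : ℝ} (hg : ∀ y, |g y| ≤ C) :
    ∫ ω, g (X t ω) ∂(Pr x) = semigroup Q t g x := by
  have := hX.prob x
  let _ : MeasurableSpace E := ⊤
  have hXm : Measurable (X t) :=
    measurable_to_countable' fun y => ℱ.le t _ (hX.adapted t y)
  have hgm : Measurable g := measurable_from_top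
  have := Measure.isProbabilityMeasure_map (μ := Pr x) hXm.aemeasurable
  rw [← integral_map hXm.aemeasurable hgm.aestronglyMeasurable,
    integral_countable (integrable_of_abs_le hgm hg)]
  refine tsum_congr fun y => ?_
  rw [Measure.real, Measure.map_apply hXm (measurableSet_singleton y), hX.measure_preimage,
    smul_eq_mul, mul_comm]

end Law

/-! ### The function `psi` and the carré du champ of truncations -/

section Psi

/-- Contractions decrease the carré du champ. -/
theorem carre_mono {u f : E → ℝ} (h : ∀ y z, |u y - u z| ≤ |f y - f z|) (x : E) :
    carre Q u x ≤ carre Q f x := by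
  unfold carre
  gcongr 2⁻¹ * ∑' y, ENNReal.ofReal ?_ * _ with y
  exact sq_le_sq.2 (h y x)

variable [MetricSpace E] {f : E → ℝ}

theorem abs_sub_le_lipNorm (hf : ∃ K : ℝ≥0, LipschitzWith K f) (x y : E) :
    |f x - f y| ≤ lipNorm f * dist x y := by
  obtain ⟨K, hK⟩ := hf
  have hbdd : BddAbove (Set.range fun p : E × E => |f p.1 - f p.2| / dist p.1 p.2) := by
    refine ⟨K, ?_⟩
    rintro _ ⟨p, rfl⟩
    refine div_le_of_le_mul₀ dist_nonneg K.2 ?_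
    simpa [Real.dist_eq] using hK.dist_le_mul p.1 p.2
  rcases eq_or_ne x y with rfl | hxy
  · simp
  · rw [← div_le_iff₀ (dist_pos.2 hxy)]
    exact le_ciSup hbdd (x, y)

theorem lipNorm_nonneg (f : E → ℝ) : 0 ≤ lipNorm f :=
  Real.iSup_nonneg fun _ => div_nonneg (abs_nonneg _) dist_nonneg

/-- The supremum norm of `∑_y (f(y) - f(·))² ((e^{l ‖f‖ d(·, y)} - 1) / (‖f‖ d(·, y)))² Q(·, y)`
in the definition of `psi`. -/
noncomputable def expJumpSup (Q : E → E → ℝ≥0) (f : E → ℝ) (l : ℝ) : ℝ≥0∞ :=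
  ⨆ x, ∑' y, ENNReal.ofReal ((f y - f x) ^ 2 *
      ((Real.exp (l * lipNorm f * dist x y) - 1) / (lipNorm f * dist x y)) ^ 2) * (Q x y : ℝ≥0∞)

theorem psi_eq (Q : E → E → ℝ≥0) (ρ : ℝ) (f : E → ℝ) (t l : ℝ) :
    psi Q ρ f t l = ENNReal.ofReal (Real.sqrt 2 * curvTime t ρ) * carreSup Q f ^ (1 / 2 : ℝ) *
      expJumpSup Q f l ^ (1 / 2 : ℝ) := rfl

theorem expJumpSup_mono (Q : E → E → ℝ≥0) (f : E → ℝ) {l l' : ℝ} (hl : 0 ≤ l) (h : l ≤ l') :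
    expJumpSup Q f l ≤ expJumpSup Q f l' := by
  unfold expJumpSup
  refine iSup_mono fun x => ENNReal.tsum_le_tsum fun y => ?_
  have hd : 0 ≤ lipNorm f * dist x y := mul_nonneg (lipNorm_nonneg f) dist_nonneg
  have h0 : 0 ≤ Real.exp (l * lipNorm f * dist x y) - 1 := by
    rw [sub_nonneg, Real.one_le_exp_iff, mul_assoc]
    positivity
  gcongr
  · exact lipNorm_nonneg f

theorem psi_mono (Q : E → E → ℝ≥0) (ρ : ℝ) (f : E → ℝ) (t : ℝ) {l l' : ℝ} (hl : 0 ≤ l)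
    (h : l ≤ l') : psi Q ρ f t l ≤ psi Q ρ f t l' := by
  rw [psi_eq, psi_eq]
  gcongr
  exact expJumpSup_mono Q f hl h

/-- Finiteness of `psi` is not due to the convention `0 · ∞ = 0`: if `Γ f = 0` then `f` is constant
along jumps, so that `expJumpSup` vanishes too. -/
theorem expJumpSup_lt_top {ρ t l : ℝ} (ht : 0 < t) (h : psi Q ρ f t l < ⊤) :
    expJumpSup Q f l < ⊤ := by
  by_cases h0 : carreSup Q f = 0
  · have hz : expJumpSup Q f l = 0 := by
      refine le_antisymm (iSup_le fun x => ?_) zero_le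
      have hx : carre Q f x = 0 := le_antisymm ((le_iSup _ x).trans h0.le) zero_le
      rw [carre, mul_eq_zero, or_iff_right (by simp), ENNReal.tsum_eq_zero] at hx
      refine (ENNReal.tsum_eq_zero.2 fun y => ?_).le
      rcases mul_eq_zero.1 (hx y) with h | h
      · have hz : (f y - f x) ^ 2 = 0 := le_antisymm (ENNReal.ofReal_eq_zero.1 h) (sq_nonneg _)
        rw [hz]
        simp
      · rw [h, mul_zero]
    rw [hz]
    exact ENNReal.zero_lt_top
  · by_contra hS
    rw [not_lt, top_le_iff] at hS
    refine h.ne ?_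
    rw [psi_eq, hS, ENNReal.top_rpow_of_pos (by norm_num), ENNReal.mul_top]
    refine mul_ne_zero ?_ ?_
    · exact (ENNReal.ofReal_pos.2 (mul_pos (by positivity) (curvTime_pos ht ρ))).ne'
    · simpa using h0

theorem exp_sub_one_div_mono {l δ c : ℝ} (hδ : 0 < δ) (hδc : δ ≤ c) :
    (Real.exp (l * δ) - 1) / δ ≤ (Real.exp (l * c) - 1) / c := by
  have hc : 0 < c := hδ.trans_le hδc
  have h := convexOn_exp.2 (Set.mem_univ (l * c)) (Set.mem_univ (0 : ℝ))
    (show 0 ≤ δ / c by positivity) (sub_nonneg.2 ((div_le_one hc).2 hδc)) (by ring)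
  simp only [smul_eq_mul, mul_zero, add_zero, Real.exp_zero, mul_one] at h
  have h2 : δ / c * (l * c) = l * δ := by field_simp
  rw [h2] at h
  rw [div_le_iff₀ hδ]
  calc Real.exp (l * δ) - 1 ≤ δ / c * Real.exp (l * c) + (1 - δ / c) - 1 := by linarith
    _ = (Real.exp (l * c) - 1) / c * δ := by ring

theorem abs_exp_sub_one_le (r : ℝ) : |Real.exp r - 1| ≤ Real.exp |r| - 1 := by
  rcases le_total 0 r with h | h
  · rw [abs_of_nonneg h, abs_of_nonneg (sub_nonneg.2 (Real.one_le_exp h))]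
  · rw [abs_of_nonpos h, abs_of_nonpos (sub_nonpos.2 (Real.exp_le_one_iff.2 h))]
    have h1 := Real.add_one_le_exp r
    have h2 := Real.add_one_le_exp (-r)
    have h3 : Real.exp r * Real.exp (-r) = 1 := by rw [← Real.exp_add]; simp
    nlinarith [sq_nonneg (Real.exp r - Real.exp (-r)), Real.exp_pos r, Real.exp_pos (-r)]

theorem sq_exp_sub_exp_le (hf : ∃ K : ℝ≥0, LipschitzWith K f) {u : E → ℝ}
    (hu : ∀ y z, |u y - u z| ≤ |f y - f z|) {l : ℝ} (hl : 0 ≤ l) (x y : E) :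
    (Real.exp (l * u y) - Real.exp (l * u x)) ^ 2 ≤ Real.exp (l * u x) ^ 2 * ((f y - f x) ^ 2 *
      ((Real.exp (l * lipNorm f * dist x y) - 1) / (lipNorm f * dist x y)) ^ 2) := by
  have hfac : Real.exp (l * u y) - Real.exp (l * u x) =
      Real.exp (l * u x) * (Real.exp (l * (u y - u x)) - 1) := by
    rw [mul_sub, ← Real.exp_add]; ring_nf
  rw [hfac, mul_pow, ← mul_pow (f y - f x)]
  refine mul_le_mul_of_nonneg_left (sq_le_sq.2 ?_) (sq_nonneg _)
  have h1 : |Real.exp (l * (u y - u x)) - 1| ≤ Real.exp (l * |f y - f x|) - 1 := by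
    refine (abs_exp_sub_one_le _).trans (sub_le_sub_right (Real.exp_le_exp.2 ?_) 1)
    rw [abs_mul, abs_of_nonneg hl]
    exact mul_le_mul_of_nonneg_left (hu y x) hl
  refine h1.trans ?_
  rcases eq_or_ne (f y) (f x) with h | h
  · simp [h]
  · have hpos : 0 < |f y - f x| := abs_pos.2 (sub_ne_zero.2 h)
    have hle : |f y - f x| ≤ lipNorm f * dist x y := by
      rw [dist_comm]; exact abs_sub_le_lipNorm hf y x
    rw [abs_mul]
    calc Real.exp (l * |f y - f x|) - 1
        = |f y - f x| * ((Real.exp (l * |f y - f x|) - 1) / |f y - f x|) := by field_simp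
      _ ≤ _ := by
        refine mul_le_mul_of_nonneg_left ?_ (abs_nonneg _)
        rw [mul_assoc l]
        exact (exp_sub_one_div_mono hpos hle).trans (le_abs_self _)

theorem carre_exp_le (hf : ∃ K : ℝ≥0, LipschitzWith K f) {u : E → ℝ}
    (hu : ∀ y z, |u y - u z| ≤ |f y - f z|) {l : ℝ} (hl : 0 ≤ l)
    (hS : expJumpSup Q f l < ⊤) (x : E) :
    carre Q (fun y => Real.exp (l * u y)) x ^ (1 / 2 : ℝ) ≤
      ENNReal.ofReal (((2⁻¹ * expJumpSup Q f l) ^ (1 / 2 : ℝ)).toReal * Real.exp (l * u x)) := by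
  have hfin : (2⁻¹ * expJumpSup Q f l) ^ (1 / 2 : ℝ) ≠ ⊤ := by
    finiteness
  have h1 : carre Q (fun y => Real.exp (l * u y)) x ≤
      ENNReal.ofReal (Real.exp (l * u x)) ^ 2 * (2⁻¹ * expJumpSup Q f l) := by
    calc carre Q (fun y => Real.exp (l * u y)) x
        ≤ 2⁻¹ * ∑' y, ENNReal.ofReal (Real.exp (l * u x)) ^ 2 * (ENNReal.ofReal ((f y - f x) ^ 2 *
          ((Real.exp (l * lipNorm f * dist x y) - 1) / (lipNorm f * dist x y)) ^ 2) *
            (Q x y : ℝ≥0∞)) := by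
          unfold carre
          gcongr 2⁻¹ * ∑' y, ?_ with y
          rw [← mul_assoc, ← ENNReal.ofReal_pow (Real.exp_pos _).le,
            ← ENNReal.ofReal_mul (sq_nonneg _)]
          gcongr
          exact sq_exp_sub_exp_le hf hu hl x y
      _ ≤ _ := by
          rw [ENNReal.tsum_mul_left, mul_left_comm]
          gcongr
          exact le_iSup (fun x => ∑' y, ENNReal.ofReal ((f y - f x) ^ 2 *
            ((Real.exp (l * lipNorm f * dist x y) - 1) / (lipNorm f * dist x y)) ^ 2) *
              (Q x y : ℝ≥0∞)) x
  refine (ENNReal.rpow_le_rpow h1 (by norm_num)).trans ?_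
  rw [ENNReal.mul_rpow_of_nonneg _ _ (by norm_num), ← ENNReal.rpow_natCast, ← ENNReal.rpow_mul,
    ENNReal.ofReal_mul ENNReal.toReal_nonneg, ENNReal.ofReal_toReal hfin, mul_comm]
  norm_num

/-- `psi` as the constant `2 A κ L_{t,ρ}` of the covariance inequality, with
`A = ‖Γ f‖_∞^{1/2}` and `κ` from `carre_exp_le`. -/
theorem psi_toReal {ρ t : ℝ} (ht : 0 < t) (Q : E → E → ℝ≥0) (f : E → ℝ) (l : ℝ) :
    (psi Q ρ f t l).toReal = 2 * (carreSup Q f ^ (1 / 2 : ℝ)).toReal *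
      ((2⁻¹ * expJumpSup Q f l) ^ (1 / 2 : ℝ)).toReal * curvTime t ρ := by
  have h2 : (2⁻¹ : ℝ) ^ (1 / 2 : ℝ) * 2 = Real.sqrt 2 := by
    rw [← Real.sqrt_eq_rpow, Real.sqrt_inv]
    field_simp
    simp
  rw [psi_eq, ENNReal.toReal_mul, ENNReal.toReal_mul, ENNReal.toReal_ofReal
    (mul_nonneg (Real.sqrt_nonneg _) (curvTime_pos ht ρ).le),
    ENNReal.mul_rpow_of_nonneg _ _ (by norm_num), ENNReal.toReal_mul, ← ENNReal.toReal_rpow 2⁻¹,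
    ENNReal.toReal_inv, ENNReal.toReal_ofNat, ← h2]
  ring

theorem mem_psiInterval {ρ t l : ℝ} (hl : l ∈ psiInterval Q ρ f t) :
    0 < l ∧ ∃ l₁, l < l₁ ∧ psi Q ρ f t l₁ < ⊤ := by
  refine ⟨hl.1, ?_⟩
  obtain ⟨_, ⟨l₁, hl₁, rfl⟩, h⟩ := lt_sSup_iff.1 hl.2
  exact ⟨l₁, (ENNReal.ofReal_lt_ofReal_iff hl₁.1).1 h, hl₁.2⟩

end Psi

/-! ### Covariance bounds for truncations of `f` -/

section Truncated

variable {𝒜 : Subalgebra ℝ (E → ℝ)} {ρ : ℝ}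
  {f : E → ℝ} {t : ℝ}

theorem carre_clamp_le (hΓ : carreSup Q f < ⊤) (n : ℕ) (y : E) :
    carre Q (fun y => clamp n (f y)) y ^ (1 / 2 : ℝ) ≤
      ENNReal.ofReal (carreSup Q f ^ (1 / 2 : ℝ)).toReal := by
  rw [ENNReal.ofReal_toReal (by finiteness)]
  gcongr
  exact (carre_mono (fun _ _ => abs_clamp_sub_le n _ _) y).trans (le_iSup (carre Q f) y)

theorem IsRegular.variance_clamp_le [Countable E] (hQ : IsRegular Q)
    (h𝒜 : ∀ g : E → ℝ, (∃ C : ℝ, ∀ x, |g x| ≤ C) → g ∈ 𝒜) (hρ : GammaCurvatureGE Q 𝒜 ρ)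
    (hΓ : carreSup Q f < ⊤) (ht : 0 ≤ t) (n : ℕ) (x : E) :
    semigroup Q t (fun y => clamp n (f y) * clamp n (f y)) x -
      semigroup Q t (fun y => clamp n (f y)) x * semigroup Q t (fun y => clamp n (f y)) x ≤
      2 * (carreSup Q f ^ (1 / 2 : ℝ)).toReal * (carreSup Q f ^ (1 / 2 : ℝ)).toReal *
        curvTime t ρ := by
  have hΓn := carre_clamp_le hΓ n
  have h := hQ.covariance_le h𝒜 hρ (w := fun _ => 1) (Cw := 1)
    (κ := (carreSup Q f ^ (1 / 2 : ℝ)).toReal) (fun y => abs_clamp_le n (f y))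
    (fun y => abs_clamp_le n (f y)) (by simp) (by simp) ENNReal.toReal_nonneg
    ENNReal.toReal_nonneg hΓn (by simpa only [mul_one] using hΓn) ht x
  rwa [hQ.semigroup_const ht, mul_one] at h

theorem abs_exp_mul_clamp_le {l : ℝ} (hl : 0 ≤ l) (n : ℕ) (r : ℝ) :
    |Real.exp (l * clamp n r)| ≤ Real.exp (l * n) := by
  rw [Real.abs_exp, Real.exp_le_exp]
  exact mul_le_mul_of_nonneg_left ((le_abs_self _).trans (abs_clamp_le n r)) hl

theorem IsRegular.covariance_exp_clamp_le [Countable E] [MetricSpace E] (hQ : IsRegular Q)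
    (h𝒜 : ∀ g : E → ℝ, (∃ C : ℝ, ∀ x, |g x| ≤ C) → g ∈ 𝒜) (hρ : GammaCurvatureGE Q 𝒜 ρ)
    (hf : ∃ K : ℝ≥0, LipschitzWith K f) (hΓ : carreSup Q f < ⊤) (ht : 0 < t) {l : ℝ}
    (hl : 0 ≤ l) (hψ : psi Q ρ f t l < ⊤) (n : ℕ) (x : E) :
    semigroup Q t (fun y => clamp n (f y) * Real.exp (l * clamp n (f y))) x -
      semigroup Q t (fun y => clamp n (f y)) x *
        semigroup Q t (fun y => Real.exp (l * clamp n (f y))) x ≤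
      (psi Q ρ f t l).toReal * semigroup Q t (fun y => Real.exp (l * clamp n (f y))) x := by
  have hΓn := carre_clamp_le hΓ n
  rw [psi_toReal ht]
  exact hQ.covariance_le h𝒜 hρ (fun y => abs_clamp_le n (f y))
    (fun y => abs_exp_mul_clamp_le hl n (f y)) (fun y => abs_exp_mul_clamp_le hl n (f y))
    (fun y => (Real.exp_pos _).le) ENNReal.toReal_nonneg ENNReal.toReal_nonneg hΓn
    (carre_exp_le hf (fun _ _ => abs_clamp_sub_le n _ _) hl (expJumpSup_lt_top ht hψ)) ht.le x

end Truncated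

end MarkovDeviation

open MarkovDeviation in
theorem theorem3p4 {E : Type*} [MetricSpace E] [Countable E]
    (Q : E → E → ℝ≥0) (hQ : MarkovDeviation.IsRegular Q)
    {Ω : Type*} {m : MeasurableSpace Ω} (ℱ : Filtration ℝ≥0 m)
    (Pr : E → Measure Ω) (X : ℝ≥0 → Ω → E)
    (hX : MarkovDeviation.IsMarkovChain Q ℱ Pr X)
    (𝒜 : Subalgebra ℝ (E → ℝ))
    (h𝒜 : ∀ g : E → ℝ, (∃ C : ℝ, ∀ x, |g x| ≤ C) → g ∈ 𝒜)
    (ρ : ℝ) (hρ : MarkovDeviation.GammaCurvatureGE Q 𝒜 ρ)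
    (f : E → ℝ) (hf𝒜 : f ∈ 𝒜) (hfLip : ∃ K : ℝ≥0, LipschitzWith K f)
    (hΓ : MarkovDeviation.carreSup Q f < ⊤)
    (t : ℝ≥0) (ht : 0 < t) (x : E) :
    Integrable (fun ω => f (X t ω)) (Pr x) ∧
    (∀ l ∈ MarkovDeviation.psiInterval Q ρ f t,
      Integrable (fun ω => Real.exp (l * (f (X t ω) - ∫ ω', f (X t ω') ∂(Pr x)))) (Pr x) ∧
      DifferentiableAt ℝ (mgf (fun ω => f (X t ω) - ∫ ω', f (X t ω') ∂(Pr x)) (Pr x)) l ∧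
      deriv (mgf (fun ω => f (X t ω) - ∫ ω', f (X t ω') ∂(Pr x)) (Pr x)) l ≤
        (MarkovDeviation.psi Q ρ f t l).toReal *
          mgf (fun ω => f (X t ω) - ∫ ω', f (X t ω') ∂(Pr x)) (Pr x) l) ∧
    (∀ y : ℝ, 0 < y →
      Pr x {ω | y ≤ f (X t ω) - ∫ ω', f (X t ω') ∂(Pr x)} ≤
        EReal.exp (⨅ l ∈ MarkovDeviation.psiInterval Q ρ f t,
          ((∫ τ in (0 : ℝ)..l, ((MarkovDeviation.psi Q ρ f t τ).toReal - y) : ℝ) : EReal))) := by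
  have hprob := hX.prob x
  have htR : (0 : ℝ) < t := ht
  have hY : Measurable fun ω => f (X t ω) := hX.measurable_comp t f
  have hcb : ∀ n y, |clamp n (f y)| ≤ n := fun n y => abs_clamp_le n (f y)
  have hint1 : ∀ n : ℕ, ∫ ω, clamp n (f (X t ω)) ∂(Pr x) =
      semigroup Q t (fun y => clamp n (f y)) x := fun n =>
    hX.integral_eq_semigroup t x (g := fun y => clamp n (f y)) (hcb n)
  have hYi : Integrable (fun ω => f (X t ω)) (Pr x) := by
    refine integrable_of_variance_clamp_le hY (V := 2 * (carreSup Q f ^ (1 / 2 : ℝ)).toReal *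
      (carreSup Q f ^ (1 / 2 : ℝ)).toReal * curvTime t ρ) fun n => ?_
    have h2 := hX.integral_eq_semigroup t x (g := fun y => clamp n (f y) * clamp n (f y))
      (C := n * n) fun y => by
        rw [abs_mul]; exact mul_le_mul (hcb n y) (hcb n y) (abs_nonneg _) (Nat.cast_nonneg _)
    rw [h2, hint1]
    exact hQ.variance_clamp_le h𝒜 hρ hΓ htR.le n x
  have hcov : ∀ l, 0 ≤ l → psi Q ρ f t l < ⊤ → ∀ n : ℕ,
      ∫ ω, clamp n (f (X t ω)) * Real.exp (l * clamp n (f (X t ω))) ∂(Pr x) -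
        (∫ ω, clamp n (f (X t ω)) ∂(Pr x)) * ∫ ω, Real.exp (l * clamp n (f (X t ω))) ∂(Pr x) ≤
      (psi Q ρ f t l).toReal * ∫ ω, Real.exp (l * clamp n (f (X t ω))) ∂(Pr x) := by
    intro l hl hψ n
    have h2 := hX.integral_eq_semigroup t x (g := fun y => Real.exp (l * clamp n (f y)))
      fun y => abs_exp_mul_clamp_le hl n (f y)
    have h3 := hX.integral_eq_semigroup t x
      (g := fun y => clamp n (f y) * Real.exp (l * clamp n (f y))) (C := n * Real.exp (l * n))
      fun y => by
        rw [abs_mul]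
        exact mul_le_mul (hcb n y) (abs_exp_mul_clamp_le hl n (f y)) (abs_nonneg _)
          (Nat.cast_nonneg _)
    rw [h2, h3, hint1]
    exact hQ.covariance_exp_clamp_le h𝒜 hρ hfLip hΓ htR hl hψ n x
  set M := ∫ ω', f (X t ω') ∂(Pr x) with hM
  have hψint : ∀ l, psi Q ρ f t l < ⊤ →
      IntegrableOn (fun τ => (psi Q ρ f t τ).toReal) (Set.Icc 0 l) := fun l hl => by
    refine MonotoneOn.integrableOn_isCompact isCompact_Icc fun τ hτ τ' hτ' h => ?_
    exact ENNReal.toReal_mono ((psi_mono Q ρ f t hτ'.1 hτ'.2).trans_lt hl).ne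
      (psi_mono Q ρ f t hτ.1 h)
  have hexp : ∀ l, 0 ≤ l → psi Q ρ f t l < ⊤ →
      Integrable (fun ω => Real.exp (l * (f (X t ω) - M))) (Pr x) ∧
      ∫ ω, Real.exp (l * (f (X t ω) - M)) ∂(Pr x) ≤
        Real.exp (∫ τ in (0 : ℝ)..l, (psi Q ρ f t τ).toReal) := fun l hl hψ =>
    exp_moment_of_clamp hY hYi fun n =>
      integral_exp_sub_le_of_covariance_le ((measurable_clamp n).comp hY)
        (fun ω => hcb n (X t ω)) hl (hψint l hψ) fun τ hτ =>
          hcov τ hτ.1.le ((psi_mono Q ρ f t hτ.1.le hτ.2.le).trans_lt hψ) n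
  have hψl : ∀ l ∈ psiInterval Q ρ f t, 0 ≤ l ∧ psi Q ρ f t l < ⊤ := fun l hl => by
    obtain ⟨h0, l₁, h1, h2⟩ := mem_psiInterval hl
    exact ⟨h0.le, (psi_mono Q ρ f t h0.le h1.le).trans_lt h2⟩
  refine ⟨hYi, fun l hl => ?_, fun y _ => ?_⟩
  · obtain ⟨h0, l₁, h1, hψ₁⟩ := mem_psiInterval hl
    have hsub : Set.Ioo 0 l₁ ⊆ integrableExpSet (fun ω => f (X t ω) - M) (Pr x) := fun τ hτ =>
      (hexp τ hτ.1.le ((psi_mono Q ρ f t hτ.1.le hτ.2.le).trans_lt hψ₁)).1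
    have hmem : l ∈ interior (integrableExpSet (fun ω => f (X t ω) - M) (Pr x)) :=
      interior_maximal hsub isOpen_Ioo ⟨h0, h1⟩
    have hfac : ∀ τ ω, Real.exp (τ * (f (X t ω) - M)) =
        Real.exp (-(τ * M)) * Real.exp (τ * f (X t ω)) := fun τ ω => by
      rw [← Real.exp_add]; congr 1; ring
    have hmem' : l ∈ interior (integrableExpSet (fun ω => f (X t ω)) (Pr x)) := by
      refine interior_maximal (fun τ hτ => ?_) isOpen_Ioo (show l ∈ Set.Ioo 0 l₁ from ⟨h0, h1⟩)
      refine ((hsub hτ).const_mul (Real.exp (τ * M))).congr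
        (Filter.Eventually.of_forall fun ω => ?_)
      simp only
      rw [← Real.exp_add]; congr 1; ring
    refine ⟨interior_subset (s := integrableExpSet _ _) hmem, differentiableAt_mgf hmem, ?_⟩
    have hlim := covariance_exp_le_of_clamp hY hYi h0.le hmem'
      (hcov l h0.le ((psi_mono Q ρ f t h0.le h1.le).trans_lt hψ₁))
    have hE : Integrable (fun ω => Real.exp (l * f (X t ω))) (Pr x) :=
      interior_subset (s := integrableExpSet _ _) hmem'
    have hYE : Integrable (fun ω => f (X t ω) * Real.exp (l * f (X t ω))) (Pr x) := by
      simpa using integrable_pow_mul_exp_of_mem_interior_integrableExpSet hmem' 1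
    have hnum : ∫ ω, (f (X t ω) - M) * Real.exp (l * (f (X t ω) - M)) ∂(Pr x) =
        Real.exp (-(l * M)) * (∫ ω, f (X t ω) * Real.exp (l * f (X t ω)) ∂(Pr x) -
          M * ∫ ω, Real.exp (l * f (X t ω)) ∂(Pr x)) := by
      rw [← integral_const_mul M, ← integral_sub hYE (hE.const_mul M), ← integral_const_mul]
      refine integral_congr_ae (Filter.Eventually.of_forall fun ω => ?_)
      simp only [hfac]
      ring
    rw [deriv_mgf hmem, hnum, mgf]
    simp_rw [hfac]
    rw [integral_const_mul, mul_left_comm]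
    exact mul_le_mul_of_nonneg_left hlim (Real.exp_pos _).le
  · -- Chernoff's bound for each `l`; the order isomorphism `log` moves the infimum outside.
    rw [← ENNReal.exp_log (Pr x _), EReal.exp_le_exp_iff]
    refine le_iInf₂ fun l hl => ?_
    obtain ⟨h0, hψ⟩ := hψl l hl
    obtain ⟨hi, hb⟩ := hexp l h0 hψ
    rw [← EReal.exp_le_exp_iff, ENNReal.exp_log, EReal.exp_coe,
      ← ofReal_measureReal (measure_ne_top _ _)]
    refine ENNReal.ofReal_le_ofReal ((measure_ge_le_exp_mul_mgf y h0 hi).trans ?_)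
    have hψi : IntervalIntegrable (fun τ => (psi Q ρ f t τ).toReal) volume 0 l :=
      (intervalIntegrable_iff_integrableOn_Icc_of_le h0).2 (hψint l hψ)
    rw [intervalIntegral.integral_sub hψi (by simp), intervalIntegral.integral_const, sub_zero,
      smul_eq_mul, sub_eq_neg_add, Real.exp_add, neg_mul]
    exact mul_le_mul_of_nonneg_left hb (Real.exp_pos _).le
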